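/- Let $T\ge 1$ and let $\zeta(n)$, $n\in\mathbb Z$, be a $T$-periodically correlated ($T$-PC) sequence: complex random variables with mean zero and finite variance, $\mathsf E\,\zeta(n+T)\overline{\zeta(m+T)}=\mathsf E\,\zeta(n)\overline{\zeta(m)}$ for all $n,m\in\mathbb Z$, and $T$ is the least positive integer with this property. Let $\vec\zeta(n)=(\zeta(nT+1),\dots,\zeta(nT+T))^\top$ be the blocked $T$-variate stationary sequence, and suppose that it has a spectral density matrix $f=f^{\vec\zeta}$, i.e. $f$ is integrable on $(-\pi,\pi]$, Hermitian nonnegative definite almost everywhere, and $\mathsf E\,\zeta_\nu(n)\overline{\zeta_\mu(m)}=\frac1{2\pi}\int_{-\pi}^{\pi}e^{i(n-m)\lambda}f_{\nu\mu}(\lambda)\,d\lambda$. Assume the minimality condition: $f(\lambda)$ is invertible for almost every $\lambda$ and $\int_{-\pi}^{\pi}\mathrm{Tr}\,[f(\lambda)^{-1}]\,d\lambda<\infty$. Let $s\ge 0$, let $N_l,K_l\ge 0$ be integers with $N_0=K_0=0$ (the lengths, in periods, of the missing and the observed intervals), $M_l=\sum_{k=0}^{l}(N_k+K_k)$ and $\tilde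 S=\bigcup_{l=0}^{s-1}\{M_l,\dots,M_l+N_{l+1}-1\}$. Let $a:\mathbb Z\to\mathbb C$ be arbitrary coefficients (for instance with $a(\nu+\tilde jT)=\alpha(\tilde j)e^{2\pi i\tilde j\nu/T}$, $\nu=1,\dots,T$), let $\vec a(\tilde j)=(a(\tilde jT+1),\dots,a(\tilde jT+T))^\top$, and consider the functional $$A_s\vec\zeta=\sum_{l=0}^{s-1}\ \sum_{\tilde j=M_l}^{M_l+N_{l+1}-1}\vec a^\top(\tilde j)\,\vec\zeta(\tilde j)$$ and its estimates from observations of $\vec\zeta(j)$, $j\in\mathbb Z\setminus\tilde S$, that is, the elements of the closed linear span $H^-$ of the variables $\zeta_\nu(j)$, $j\in\mathbb Z\setminus\tilde S$, $\nu=1,\dots,T$, in $L^2$ of the probability space. Let $L_2(f)$ be the space of (measurable) functions $\vec b:(-\pi,\pi]\to\mathbb C^T$ with $\int_{-\pi}^{\pi}\vec b^\top f\,\overline{\vec b}\,d\lambda<\infty$, and $L_2^{s-}(f)$ the closed linear span in it of the functions $e^{ij\lambda}\delta_\nu$, $j\in\mathbb Z\setminus\tilde S$, $\nu=1,\dots,T$,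 where $\delta_\nu$ is the $\nu$-th unit vector. Let $\mathbf B_s^\zeta$ be the matrix with rows and columns indexed by $\tilde S\times\{1,\dots,T\}$ and with $T\times T$ blocks $$B^\zeta(j,k)=\frac1{2\pi}\int_{-\pi}^{\pi}\big[f(\lambda)^{-1}\big]^\top e^{i(k-j)\lambda}\,d\lambda,\qquad j,k\in\tilde S,$$ and let $\vec a_s^\zeta=(\vec a(\tilde j))_{\tilde j\in\tilde S}$ be the stacked vector of coefficients. Then $\mathbf B_s^\zeta$ is invertible. Put $\vec c_s^\zeta=(\vec c(\tilde j))_{\tilde j\in\tilde S}=(\mathbf B_s^\zeta)^{-1}\vec a_s^\zeta$, $\tilde A_s(e^{i\lambda})=\sum_{\tilde j\in\tilde S}\vec a(\tilde j)e^{i\tilde j\lambda}$, $\tilde C_s(e^{i\lambda})=\sum_{\tilde j\in\tilde S}\vec c(\tilde j)e^{i\tilde j\lambda}$, and define $\vec h$ by $$\vec h^\top=\tilde A_s^\top(e^{i\lambda})-\tilde C_s^\top(e^{i\lambda})\,[f(\lambda)]^{-1}.$$ (1) $\vec h$ is the spectral characteristic of the optimal estimate: $\vec h\in L_2^{s-}(f)$,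 and it is the unique (up to almost everywhere equality) minimizer over $\vec g\in L_2^{s-}(f)$ of $$\Delta(\vec g;f)=\frac1{2\pi}\int_{-\pi}^{\pi}\big(\tilde A_s-\vec g\big)^\top f\,\overline{\big(\tilde A_s-\vec g\big)}\,d\lambda ,$$ with minimal value $\Delta(\vec h;f)=\langle\vec c_s^\zeta,\vec a_s^\zeta\rangle$, where $\langle u,v\rangle=\sum_i u_i\overline{v_i}$. (2) The sequence $\vec\zeta$ has an orthogonal random measure $Z^{\vec\zeta}=(Z_\nu^{\vec\zeta})_{\nu=1}^T$, that is, a centred additive square integrable random set function on the Borel subsets of $(-\pi,\pi]$ with $\mathsf E\,Z_\nu^{\vec\zeta}(\Delta)\overline{Z_\mu^{\vec\zeta}(\Delta')}=\frac1{2\pi}\int_{\Delta\cap\Delta'}f_{\nu\mu}\,d\lambda$ and $\zeta_\nu(j)=\int_{-\pi}^{\pi}e^{ij\lambda}Z_\nu^{\vec\zeta}(d\lambda)$. There is exactly one optimal linear estimate $\widehat{A_s\vec\zeta}$, i.e. exactly one element of $H^-$ that minimizes $\mathsf E|A_s\vec\zeta-Y|^2$ over $Y\in H^-$. For every such measure $Z^{\vec\zeta}$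 it is given by $$\widehat{A_s\vec\zeta}=\int_{-\pi}^{\pi}\vec h^\top Z^{\vec\zeta}(d\lambda)=\int_{-\pi}^{\pi}\sum_{\nu=1}^T h_\nu\,Z_\nu^{\vec\zeta}(d\lambda),$$ and its mean square error is $\mathsf E|A_s\vec\zeta-\widehat{A_s\vec\zeta}|^2=\langle\vec c_s^\zeta,\vec a_s^\zeta\rangle$. -/

import Mathlib

open MeasureTheory
open scoped ComplexConjugate Matrix ComplexOrder

noncomputable section

namespace PCInterp

/-! ### Sequences of square integrable random variables

Random variables with finite variance are elements of `Lp ℂ 2 P`, so they are identified when they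
are almost surely equal. -/

section Sequences

variable {Ω : Type*} [MeasurableSpace Ω]

/-- The covariance `E[X * conj Y]` of two (centred) square integrable random variables. -/
def cov (P : Measure Ω) (X Y : Lp ℂ 2 P) : ℂ := ∫ ω, X ω * conj (Y ω) ∂P

/-- The mean square distance `E|X - Y|²`. -/
def mse (P : Measure Ω) (X Y : Lp ℂ 2 P) : ℝ := ∫ ω, ‖(X - Y : Lp ℂ 2 P) ω‖ ^ 2 ∂P

/-- The covariance function of `ζ` does not change when both times are shifted by `T`. -/
def HasCovPeriod (P : Measure Ω) (T : ℕ) (ζ : ℤ → Lp ℂ 2 P) : Prop :=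
  ∀ n m : ℤ, cov P (ζ (n + T)) (ζ (m + T)) = cov P (ζ n) (ζ m)

/-- `ζ` is periodically correlated with period `T`: mean zero, `T`-periodic covariance function,
and `T` is the smallest positive period. -/
structure IsPC (P : Measure Ω) (T : ℕ) (ζ : ℤ → Lp ℂ 2 P) : Prop where
  pos : 0 < T
  mean_zero : ∀ n, ∫ ω, ζ n ω ∂P = 0
  period : HasCovPeriod P T ζ
  minimal : ∀ T' : ℕ, 0 < T' → T' < T → ¬ HasCovPeriod P T' ζ

/-- The `T`-blocking of `ζ`: the component `p ∈ {1, …, T}` of the vector at time `n` is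
`ζ (n T + p)`. The index `ν : Fin T` stands for `p = ν + 1`. -/
def block {E : Type*} (T : ℕ) (ζ : ℤ → E) (n : ℤ) (ν : Fin T) : E :=
  ζ (n * T + ((ν : ℕ) + 1 : ℤ))

end Sequences

/-! ### Spectral densities and the space `L₂(f)` -/

/-- The frequency domain `(-π, π]`. -/
def freq : Set ℝ := Set.Ioc (-Real.pi) Real.pi

/-- The character `e^{ijλ}`. -/
def char (j : ℤ) (x : ℝ) : ℂ := Complex.exp (Complex.I * j * x)

section Spectral

variable {T : ℕ}

/-- `f` is the spectral density matrix of the `T`-variate sequence `X`: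
`E[X_ν(n) conj X_μ(m)] = (1/2π) ∫_{-π}^{π} e^{i(n-m)λ} f_{νμ}(λ) dλ`, where `f` is integrable
and almost everywhere Hermitian nonnegative definite. In particular `X` is then stationary. -/
structure IsSpectralDensity {Ω : Type*} [MeasurableSpace Ω] (P : Measure Ω)
    (X : ℤ → Fin T → Lp ℂ 2 P) (f : ℝ → Matrix (Fin T) (Fin T) ℂ) : Prop where
  integrable : ∀ ν μ, IntegrableOn (fun x => f x ν μ) freq
  posSemidef : ∀ᵐ x ∂(volume.restrict freq), (f x).PosSemidef
  cov_eq : ∀ (n m : ℤ) (ν μ : Fin T), cov P (X n ν) (X m μ) =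
    (1 / (2 * Real.pi) : ℂ) * ∫ x in (-Real.pi)..Real.pi, char (n - m) x * f x ν μ

/-- The minimality condition: `f` is invertible almost everywhere and
`∫_{-π}^{π} Tr [f(λ)⁻¹] dλ < ∞`. -/
def Minimality (f : ℝ → Matrix (Fin T) (Fin T) ℂ) : Prop :=
  (∀ᵐ x ∂(volume.restrict freq), IsUnit (f x).det) ∧
    IntegrableOn (fun x => ((f x)⁻¹).trace) freq

/-- The density `bᵀ(λ) f(λ) conj (b(λ))`. It is real and nonnegative where `f` is nonnegative
definite. -/
def quad (f : ℝ → Matrix (Fin T) (Fin T) ℂ) (b : ℝ → Fin T → ℂ) (x : ℝ) : ℂ :=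
  ∑ ν, ∑ μ, b x ν * f x ν μ * conj (b x μ)

/-- Membership in `L₂(f)`. -/
def MemL2 (f : ℝ → Matrix (Fin T) (Fin T) ℂ) (b : ℝ → Fin T → ℂ) : Prop :=
  (∀ ν, AEStronglyMeasurable (fun x => b x ν) (volume.restrict freq)) ∧
    IntegrableOn (quad f b) freq

/-- The squared distance `(1/2π) ∫_{-π}^{π} (b - g)ᵀ f conj (b - g) dλ` in `L₂(f)`. -/
def sqDist (f : ℝ → Matrix (Fin T) (Fin T) ℂ) (b g : ℝ → Fin T → ℂ) : ℝ :=
  1 / (2 * Real.pi) * ∫ x in (-Real.pi)..Real.pi, (quad f (fun y => b y - g y) x).re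

/-- The vector trigonometric polynomial `∑_{j ∈ F} p(j) e^{ijλ}`. -/
def trigPoly (F : Finset ℤ) (p : ℤ → Fin T → ℂ) (x : ℝ) : Fin T → ℂ :=
  ∑ j ∈ F, char j x • p j

/-- The subspace `L₂^{s-}(f)`: the closure in `L₂(f)` of the linear span of the functions
`e^{ijλ} δ_ν`, `j ∈ ℤ \ S`, `ν = 1, …, T`. -/
def MemL2Minus (f : ℝ → Matrix (Fin T) (Fin T) ℂ) (S : Finset ℤ) (b : ℝ → Fin T → ℂ) : Prop :=
  MemL2 f b ∧ ∀ ε > 0, ∃ (F : Finset ℤ) (p : ℤ → Fin T → ℂ),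
    Disjoint F S ∧ sqDist f b (trigPoly F p) < ε

end Spectral

/-! ### Orthogonal random measures and stochastic integrals -/

section RandomMeasure

variable {T : ℕ} {Ω : Type*} [MeasurableSpace Ω]

/-- `X = ∫ bᵀ(λ) Z(dλ)` for `b ∈ L₂(f)`: `X` is the mean square limit of the integrals
`∑_i v_iᵀ Z(Δ_i)` of simple functions `∑_i v_i 1_{Δ_i}` which converge to `b` in `L₂(f)`. -/
def IsStochIntegral (P : Measure Ω) (f : ℝ → Matrix (Fin T) (Fin T) ℂ)
    (Z : Fin T → Set ℝ → Lp ℂ 2 P) (b : ℝ → Fin T → ℂ) (X : Lp ℂ 2 P) : Prop :=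
  MemL2 f b ∧ ∀ ε > 0, ∃ (n : ℕ) (Δ : Fin n → Set ℝ) (v : Fin n → Fin T → ℂ),
    (∀ i, MeasurableSet (Δ i) ∧ Δ i ⊆ freq) ∧
    sqDist f b (fun x => ∑ i, (Δ i).indicator (fun _ => v i) x) < ε ∧
    mse P X (∑ i, ∑ ν, v i ν • Z ν (Δ i)) < ε

/-- `Z = (Z_ν)` is the orthogonal random measure of the `T`-variate stationary sequence `X` with
spectral density `f`: it is a centred additive set function on the Borel subsets of `(-π, π]` with
`E[Z_ν(Δ) conj Z_μ(Δ')] = (1/2π) ∫_{Δ ∩ Δ'} f_{νμ}(λ) dλ`, and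
`X_ν(j) = ∫ e^{ijλ} Z_ν(dλ)`. -/
structure IsRandomSpectralMeasure (P : Measure Ω) (X : ℤ → Fin T → Lp ℂ 2 P)
    (f : ℝ → Matrix (Fin T) (Fin T) ℂ) (Z : Fin T → Set ℝ → Lp ℂ 2 P) : Prop where
  mean_zero : ∀ ν Δ, MeasurableSet Δ → Δ ⊆ freq → ∫ ω, Z ν Δ ω ∂P = 0
  additive : ∀ ν Δ Δ', MeasurableSet Δ → Δ ⊆ freq → MeasurableSet Δ' → Δ' ⊆ freq →
    Disjoint Δ Δ' → Z ν (Δ ∪ Δ') = Z ν Δ + Z ν Δ'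
  orthogonal : ∀ ν μ Δ Δ', MeasurableSet Δ → Δ ⊆ freq → MeasurableSet Δ' → Δ' ⊆ freq →
    cov P (Z ν Δ) (Z μ Δ') = (1 / (2 * Real.pi) : ℂ) * ∫ x in Δ ∩ Δ', f x ν μ
  representation : ∀ (j : ℤ) (ν : Fin T),
    IsStochIntegral P f Z (fun x => Pi.single ν (char j x)) (X j ν)

/-- The space `H⁻` of linear estimates: the closed linear span of the values `X_ν(j)`,
`j ∈ ℤ \ S`, `ν = 1, …, T`. -/
def observed (P : Measure Ω) (X : ℤ → Fin T → Lp ℂ 2 P) (S : Finset ℤ) :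
    Submodule ℂ (Lp ℂ 2 P) :=
  (Submodule.span ℂ {Y | ∃ j : ℤ, j ∉ S ∧ ∃ ν, Y = X j ν}).topologicalClosure

/-- `Y` is an optimal (mean square) linear estimate of `A` based on the observations of `X` at the
points of `ℤ \ S`. -/
def IsOptimalEstimate (P : Measure Ω) (X : ℤ → Fin T → Lp ℂ 2 P) (S : Finset ℤ)
    (A Y : Lp ℂ 2 P) : Prop :=
  Y ∈ observed P X S ∧ ∀ Y' ∈ observed P X S, mse P A Y ≤ mse P A Y'

end RandomMeasure

/-! ### The interpolation problem

The lengths `N l`, `K l` are measured in periods: the univariate sequence has missing intervals of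
`T * N l` points and observed gaps of `T * K l` points. -/

/-- `M_l = ∑_{k=0}^{l} (N_k + K_k)`. -/
def start (N K : ℕ → ℕ) (l : ℕ) : ℕ := ∑ k ∈ Finset.range (l + 1), (N k + K k)

/-- The set of missing times `⋃_{l=0}^{s-1} {M_l, …, M_l + N_{l+1} - 1}`. -/
def missing (s : ℕ) (N K : ℕ → ℕ) : Finset ℤ :=
  (Finset.range s).biUnion fun l => Finset.Ico (start N K l : ℤ) (start N K l + N (l + 1))

section Problem

variable {T : ℕ}

/-- The functional `∑_{l=0}^{s-1} ∑_{j=M_l}^{M_l+N_{l+1}-1} aᵀ(j) X(j)`. -/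
def functional {E : Type*} [AddCommGroup E] [Module ℂ E] (s : ℕ) (N K : ℕ → ℕ)
    (a : ℤ → Fin T → ℂ) (X : ℤ → Fin T → E) : E :=
  ∑ l ∈ Finset.range s, ∑ j ∈ Finset.Ico (start N K l : ℤ) (start N K l + N (l + 1)),
    ∑ ν, a j ν • X j ν

/-- The matrix `B` with the `T × T` blocks
`B(j, k) = (1/2π) ∫_{-π}^{π} [f(λ)⁻¹]ᵀ e^{i(k-j)λ} dλ`, `j, k ∈ S`. -/
def matB (f : ℝ → Matrix (Fin T) (Fin T) ℂ) (S : Finset ℤ) :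
    Matrix (S × Fin T) (S × Fin T) ℂ :=
  Matrix.of fun p q => (1 / (2 * Real.pi) : ℂ) *
    ∫ x in (-Real.pi)..Real.pi, ((f x)⁻¹)ᵀ p.2 q.2 * char ((q.1 : ℤ) - (p.1 : ℤ)) x

/-- The stacked vector of the coefficients `a(j)`, `j ∈ S`. -/
def stack (S : Finset ℤ) (a : ℤ → Fin T → ℂ) : S × Fin T → ℂ := fun p => a p.1 p.2

/-- The vector `c = B⁻¹ a`. -/
def vecC (f : ℝ → Matrix (Fin T) (Fin T) ℂ) (S : Finset ℤ) (a : ℤ → Fin T → ℂ) :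
    S × Fin T → ℂ := (matB f S)⁻¹ *ᵥ stack S a

/-- `C(e^{iλ}) = ∑_{j ∈ S} c(j) e^{ijλ}` for a stacked vector `c`. -/
def stackPoly (S : Finset ℤ) (c : S × Fin T → ℂ) (x : ℝ) : Fin T → ℂ :=
  ∑ j : S, char j x • fun ν => c (j, ν)

/-- The function `h` with `hᵀ = Aᵀ(e^{iλ}) - Cᵀ(e^{iλ}) f(λ)⁻¹`. -/
def spectralChar (f : ℝ → Matrix (Fin T) (Fin T) ℂ) (S : Finset ℤ) (a : ℤ → Fin T → ℂ)
    (x : ℝ) : Fin T → ℂ :=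
  trigPoly S a x - stackPoly S (vecC f S a) x ᵥ* (f x)⁻¹

/-- The scalar product `⟨u, v⟩ = ∑ u_i conj v_i`. -/
def scalar {ι : Type*} [Fintype ι] (u v : ι → ℂ) : ℂ := ∑ i, u i * conj (v i)

end Problem

end PCInterp

end

open PCInterp

/-! The map `b ↦ bᵀ f^{1/2}` turns the seminorm of `L₂(f)` into the norm of the Hilbert space of
square integrable `ℂ^T`-valued functions with measure `dλ/2π`. There the exponentials `e^{ijλ} δ_ν`
form a total family: an integrable function with vanishing Fourier coefficients is zero almost
everywhere, and `f` is almost everywhere invertible (`total_basisFun`).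

Minimality puts the functions `e^{ijλ} δ_νᵀ f⁻¹` into `L₂(f)` (`memL2_dualFun`). Since `f⁻¹` cancels
`f` in the scalar product, they are biorthogonal to the exponentials (`inner_basisFun_dualFun`).
Hence `L₂^{s-}(f)` is cut out by finitely many conditions, orthogonality to the dual functions with
times in `S` (`memL2Minus_iff_inner`), and `B` is the Gram matrix of these independent functions,
hence invertible (`matB_eq_gram`, `isUnit_det_matB`). The difference `A - h` is their combination
with coefficients `c`, and `B c = a` says precisely that `h` is orthogonal to each of them. So `h`
is the orthogonal projection of `A`; Pythagoras gives optimality and uniqueness, and `‖A - h‖² = ⟨c,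
a⟩`.

Equality of Gram matrices yields an isometry `U` from the spectral domain to random variables with
`e^{ijλ} δ_ν ↦ X_ν(j)`, which carries the solution over to the time domain. Stochastic integration
against any admissible `Z` extends to an isometry that agrees with `U` on the exponentials, and so
equals `U`. -/

namespace PCInterp

/-! ### Hilbert space lemmas -/

section Hilbert

variable {ι σ H H' : Type*} [NormedAddCommGroup H] [InnerProductSpace ℂ H]
  [NormedAddCommGroup H'] [InnerProductSpace ℂ H']

/-- This makes the map `e i ↦ x i` well defined on linear combinations, even if `e` is linearly
dependent. -/
theorem norm_linearCombination_eq_of_inner_eq {e : ι → H} {x : ι → H'}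
    (hG : ∀ i j, inner ℂ (x i) (x j) = inner ℂ (e i) (e j)) (l : ι →₀ ℂ) :
    ‖Finsupp.linearCombination ℂ x l‖ = ‖Finsupp.linearCombination ℂ e l‖ := by
  have h : inner ℂ (Finsupp.linearCombination ℂ x l) (Finsupp.linearCombination ℂ x l) =
      inner ℂ (Finsupp.linearCombination ℂ e l) (Finsupp.linearCombination ℂ e l) := by
    simp only [Finsupp.linearCombination_apply, Finsupp.sum_inner, Finsupp.inner_sum, hG,
      inner_smul_left, inner_smul_right]
  rw [inner_self_eq_norm_sq_to_K, inner_self_eq_norm_sq_to_K] at h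
  have h2 : ‖Finsupp.linearCombination ℂ x l‖ ^ 2 = ‖Finsupp.linearCombination ℂ e l‖ ^ 2 := by
    exact_mod_cast h
  exact (sq_eq_sq₀ (norm_nonneg _) (norm_nonneg _)).1 h2

theorem topologicalClosure_span_range_eq_top [CompleteSpace H] {e : ι → H}
    (he : ∀ u, (∀ i, inner ℂ (e i) u = 0) → u = 0) :
    (Submodule.span ℂ (Set.range e)).topologicalClosure = ⊤ := by
  rw [Submodule.topologicalClosure_eq_top_iff, Submodule.eq_bot_iff]
  intro u hu
  exact he u fun i => (Submodule.mem_orthogonal _ _).1 hu _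
    (Submodule.subset_span (Set.mem_range_self i))

/-- Two families with the same Gram matrix, the first of them total, are related by a linear
isometry. -/
theorem exists_linearIsometry_of_inner_eq [CompleteSpace H] [CompleteSpace H'] {e : ι → H}
    {x : ι → H'} (he : ∀ u, (∀ i, inner ℂ (e i) u = 0) → u = 0)
    (hG : ∀ i j, inner ℂ (x i) (x j) = inner ℂ (e i) (e j)) :
    ∃ U : H →ₗᵢ[ℂ] H', ∀ i, U (e i) = x i := by
  have hd : DenseRange (Finsupp.linearCombination ℂ e) := by
    have h1 := topologicalClosure_span_range_eq_top he
    rw [← Finsupp.range_linearCombination, ← Submodule.dense_iff_topologicalClosure_eq_top] at h1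
    rwa [LinearMap.coe_range] at h1
  have hn : ∀ l, ‖Finsupp.linearCombination ℂ x l‖ ≤ 1 * ‖Finsupp.linearCombination ℂ e l‖ :=
    fun l => by rw [one_mul, norm_linearCombination_eq_of_inner_eq hG]
  have hU : ∀ l, (Finsupp.linearCombination ℂ x).extendOfNorm (Finsupp.linearCombination ℂ e)
      (Finsupp.linearCombination ℂ e l) = Finsupp.linearCombination ℂ x l :=
    fun l => LinearMap.extendOfNorm_eq hd ⟨1, hn⟩ l
  refine ⟨⟨((Finsupp.linearCombination ℂ x).extendOfNorm
    (Finsupp.linearCombination ℂ e)).toLinearMap, fun u => ?_⟩, fun i => ?_⟩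
  · refine hd.induction_on (p := fun u => ‖(Finsupp.linearCombination ℂ x).extendOfNorm
      (Finsupp.linearCombination ℂ e) u‖ = ‖u‖) u (isClosed_eq (by fun_prop) (by fun_prop)) ?_
    intro l
    rw [hU, norm_linearCombination_eq_of_inner_eq hG]
  · have := hU (Finsupp.single i 1)
    simpa using this

/-- Linear isometries which agree on a total family are equal. -/
theorem linearIsometry_ext_of_total [CompleteSpace H] {e : ι → H}
    (he : ∀ u, (∀ i, inner ℂ (e i) u = 0) → u = 0) {U V : H →ₗᵢ[ℂ] H'}
    (h : ∀ i, U (e i) = V (e i)) (u : H) : U u = V u := by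
  have hu : u ∈ (Submodule.span ℂ (Set.range e)).topologicalClosure := by
    rw [topologicalClosure_span_range_eq_top he]; trivial
  have hle : (Submodule.span ℂ (Set.range e)).topologicalClosure ≤
      LinearMap.ker (U.toContinuousLinearMap - V.toContinuousLinearMap).toLinearMap := by
    refine Submodule.topologicalClosure_minimal _ ?_
      (ContinuousLinearMap.isClosed_ker (U.toContinuousLinearMap - V.toContinuousLinearMap))
    rw [Submodule.span_le]
    rintro _ ⟨i, rfl⟩
    simp [h]
  have := hle hu
  simpa [sub_eq_zero] using this

/-- If `d` is biorthogonal to a part of a total family `e`, then the closed linear span of the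
other members of `e` is the orthogonal complement of `d`. -/
theorem mem_closure_span_iff_of_biorthogonal [CompleteSpace H] [Fintype σ] {e : ι → H}
    (he : ∀ u, (∀ i, inner ℂ (e i) u = 0) → u = 0) {j : σ → ι} (hj : Function.Injective j)
    {d : σ → H} (h1 : ∀ p, inner ℂ (e (j p)) (d p) = 1)
    (h0 : ∀ p i, i ≠ j p → inner ℂ (e i) (d p) = 0) (u : H) :
    u ∈ (Submodule.span ℂ {y | ∃ i, i ∉ Set.range j ∧ y = e i}).topologicalClosure ↔
      ∀ p, inner ℂ (d p) u = 0 := by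
  constructor
  · intro hu p
    have hle : (Submodule.span ℂ {y | ∃ i, i ∉ Set.range j ∧ y = e i}).topologicalClosure ≤
        (ℂ ∙ d p)ᗮ := by
      refine Submodule.topologicalClosure_minimal _ ?_ (Submodule.isClosed_orthogonal _)
      rw [Submodule.span_le]
      rintro _ ⟨i, hi, rfl⟩
      rw [SetLike.mem_coe, Submodule.mem_orthogonal_singleton_iff_inner_left]
      exact h0 p i fun h => hi ⟨p, h.symm⟩
    exact (Submodule.mem_orthogonal_singleton_iff_inner_right).1 (hle hu)
  · intro hu
    rw [← Submodule.orthogonal_orthogonal_eq_closure]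
    rw [Submodule.mem_orthogonal]
    intro v hv
    have hv' : ∀ i, i ∉ Set.range j → inner ℂ (e i) v = 0 := fun i hi =>
      (Submodule.mem_orthogonal _ _).1 hv _ (Submodule.subset_span ⟨i, hi, rfl⟩)
    have hvd : v = ∑ p, inner ℂ (e (j p)) v • d p := by
      rw [← sub_eq_zero]
      refine he _ fun i => ?_
      rw [inner_sub_right, inner_sum]
      simp only [inner_smul_right]
      by_cases hi : i ∈ Set.range j
      · obtain ⟨q, rfl⟩ := hi
        rw [Finset.sum_eq_single q, h1, mul_one, sub_self]
        · intro p _ hpq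
          rw [h0 p _ fun h => hpq (hj h).symm, mul_zero]
        · simp
      · rw [hv' i hi, Finset.sum_eq_zero, sub_zero]
        intro p _
        rw [h0 p _ fun h => hi ⟨p, h.symm⟩, mul_zero]
    rw [hvd, sum_inner]
    refine Finset.sum_eq_zero fun p _ => ?_
    rw [inner_smul_left, hu, mul_zero]

theorem linearIndependent_of_biorthogonal {e : ι → H} {j : σ → ι} (hj : Function.Injective j)
    {d : σ → H} (h1 : ∀ p, inner ℂ (e (j p)) (d p) = 1)
    (h0 : ∀ p i, i ≠ j p → inner ℂ (e i) (d p) = 0) : LinearIndependent ℂ d := by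
  rw [linearIndependent_iff']
  intro s g hg p hp
  have h2 : inner ℂ (e (j p)) (∑ i ∈ s, g i • d i) = g p := by
    rw [inner_sum, Finset.sum_eq_single p]
    · rw [inner_smul_right, h1, mul_one]
    · intro q _ hq
      rw [inner_smul_right, h0 q _ fun h => hq (hj h).symm, mul_zero]
    · exact fun h => absurd hp h
  rw [← h2, hg, inner_zero_right]

theorem isUnit_det_gram [Fintype σ] [DecidableEq σ] {d : σ → H}
    (hd : LinearIndependent ℂ d) : IsUnit (Matrix.gram ℂ d).det :=
  (Matrix.isUnit_iff_isUnit_det _).1 (Matrix.posDef_gram_of_linearIndependent hd).isUnit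

end Hilbert

/-! ### Uniqueness of Fourier coefficients of integrable functions -/

theorem measurableSet_freq : MeasurableSet freq := measurableSet_Ioc

theorem norm_char (j : ℤ) (x : ℝ) : ‖char j x‖ = 1 := by
  unfold char
  rw [show Complex.I * j * x = ((j * x : ℝ) : ℂ) * Complex.I by push_cast; ring]
  exact Complex.norm_exp_ofReal_mul_I _

theorem continuous_char (j : ℤ) : Continuous (char j) := by
  unfold char; fun_prop

theorem conj_char (j : ℤ) (x : ℝ) : conj (char j x) = char (-j) x := by
  unfold char
  rw [← Complex.exp_conj]
  simp

theorem char_add (j k : ℤ) (x : ℝ) : char (j + k) x = char j x * char k x := by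
  unfold char
  rw [← Complex.exp_add]
  push_cast; ring_nf

theorem char_mul_conj (j k : ℤ) (x : ℝ) : char j x * conj (char k x) = char (j - k) x := by
  rw [conj_char, ← char_add, sub_eq_add_neg]

theorem fourier_coe_two_pi (n : ℤ) (x : ℝ) :
    fourier n (x : AddCircle (2 * Real.pi)) = char n x := by
  rw [fourier_coe_apply]
  unfold char
  congr 1
  have := Real.pi_ne_zero
  push_cast
  field_simp

instance fact_two_pi_pos : Fact (0 < 2 * Real.pi) := ⟨Real.two_pi_pos⟩

/-- Trigonometric polynomials are uniformly dense in the continuous functions on the circle, and `G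
↦ ∫ G w` is Lipschitz with constant `∫ ‖w‖`. -/
theorem setIntegral_continuousMap_mul_eq_zero {w : ℝ → ℂ} (hw : IntegrableOn w freq)
    (h : ∀ j : ℤ, ∫ x in freq, char j x * w x = 0) (G : C(AddCircle (2 * Real.pi), ℂ)) :
    ∫ x in freq, G (x : AddCircle (2 * Real.pi)) * w x = 0 := by
  have hint : ∀ G : C(AddCircle (2 * Real.pi), ℂ),
      IntegrableOn (fun x : ℝ => G (x : AddCircle (2 * Real.pi)) * w x) freq := by
    intro G
    refine Integrable.bdd_mul (c := ‖G‖) hw ?_ ?_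
    · exact (G.continuous.comp (AddCircle.continuous_mk' _)).aestronglyMeasurable
    · exact Filter.Eventually.of_forall fun x => G.norm_coe_le_norm _
  have hspan : ∀ G ∈ Submodule.span ℂ (Set.range (@fourier (2 * Real.pi))),
      ∫ x in freq, G (x : AddCircle (2 * Real.pi)) * w x = 0 := by
    intro G hG
    induction hG using Submodule.span_induction with
    | mem G hG =>
      obtain ⟨n, rfl⟩ := hG
      simp only [fourier_coe_two_pi]
      exact h n
    | zero => simp
    | add G G' _ _ h1 h2 =>
      simp only [ContinuousMap.add_apply, add_mul]
      rw [integral_add (hint G) (hint G'), h1, h2, add_zero]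
    | smul c G _ h1 =>
      simp only [ContinuousMap.smul_apply, smul_eq_mul, mul_assoc]
      rw [integral_const_mul, h1, mul_zero]
  have hcont : Continuous fun G : C(AddCircle (2 * Real.pi), ℂ) =>
      ∫ x in freq, G (x : AddCircle (2 * Real.pi)) * w x := by
    refine LipschitzWith.continuous (K := (∫ x in freq, ‖w x‖).toNNReal)
      (LipschitzWith.of_dist_le_mul fun G G' => ?_)
    rw [Real.coe_toNNReal _ (integral_nonneg fun _ => norm_nonneg _), dist_eq_norm, dist_eq_norm,
      ← integral_sub (hint G) (hint G'), ← integral_mul_const]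
    refine norm_integral_le_of_norm_le (hw.norm.mul_const _)
      (Filter.Eventually.of_forall fun x => ?_)
    rw [← sub_mul, norm_mul, mul_comm]
    exact mul_le_mul_of_nonneg_left ((G - G').norm_coe_le_norm _) (norm_nonneg _)
  have hcl : IsClosed {G : C(AddCircle (2 * Real.pi), ℂ) |
      ∫ x in freq, G (x : AddCircle (2 * Real.pi)) * w x = 0} :=
    isClosed_eq hcont continuous_const
  have hG : G ∈ (Submodule.span ℂ (Set.range (@fourier (2 * Real.pi)))).topologicalClosure := by
    rw [span_fourier_closure_eq_top]; trivial
  exact closure_minimal hspan hcl hG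

/-- As `w` is only integrable, completeness of the exponentials in `L²` is not enough. It suffices
to test `w` against smooth functions with compact support in the open interval; these vanish at both
endpoints and so descend to continuous functions on the circle. -/
theorem ae_eq_zero_of_fourier_eq_zero {w : ℝ → ℂ} (hw : IntegrableOn w freq)
    (h : ∀ j : ℤ, ∫ x in freq, char j x * w x = 0) :
    ∀ᵐ x ∂(volume.restrict freq), w x = 0 := by
  have h1 : ∀ᵐ x, x ∈ Set.Ioo (-Real.pi) Real.pi → w x = 0 := by
    refine isOpen_Ioo.ae_eq_zero_of_integral_contDiff_smul_eq_zero
      ((hw.mono_set Set.Ioo_subset_Ioc_self).locallyIntegrableOn) ?_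
    intro g hg _ hsub
    have hg0 : ∀ x, x ∉ Set.Ioo (-Real.pi) Real.pi → g x = 0 := fun x hx =>
      image_eq_zero_of_notMem_tsupport fun hx' => hx (hsub hx')
    have hp : (-Real.pi + 2 * Real.pi) = Real.pi := by ring
    let φ : ℝ → ℂ := fun x => (g x : ℂ)
    have hφ : Continuous (AddCircle.liftIoc (2 * Real.pi) (-Real.pi) φ) := by
      refine AddCircle.liftIoc_continuous ?_ (Continuous.continuousOn ?_)
      · simp only [φ, hp]
        rw [hg0 _ (by simp), hg0 _ (by simp)]
      · exact Complex.continuous_ofReal.comp hg.continuous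
    have h2 := setIntegral_continuousMap_mul_eq_zero hw h ⟨_, hφ⟩
    have h3 : ∫ x in freq, g x • w x = 0 := by
      rw [← h2]
      refine setIntegral_congr_fun measurableSet_freq fun x hx => ?_
      simp only [ContinuousMap.coe_mk]
      rw [AddCircle.liftIoc_coe_apply (by rw [hp]; exact hx)]
      simp [φ]
    rw [← h3, setIntegral_eq_integral_of_forall_compl_eq_zero]
    intro x hx
    rw [hg0 x fun hx' => hx (Set.Ioo_subset_Ioc_self hx'), zero_smul]
  have h2 : volume.restrict freq = volume.restrict (Set.Ioo (-Real.pi) Real.pi) :=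
    Measure.restrict_congr_set Ioo_ae_eq_Ioc.symm
  rw [h2, ae_restrict_iff' measurableSet_Ioo]
  exact h1

/-! ### The square root of a nonnegative definite matrix -/

section Root

open scoped Matrix.Norms.L2Operator MatrixOrder

variable {n : Type*} [Fintype n] [DecidableEq n]

/-- A continuous function of the matrix `M` which is the square root of `M` for nonnegative
definite `M`. -/
noncomputable def matRoot (M : Matrix n n ℂ) : Matrix n n ℂ := CFC.sqrt (CFC.abs M)

/-- Taking the absolute value first makes the root continuous on all matrices, so `matRoot ∘ f`
inherits measurability from `f`, which is nonnegative definite only almost everywhere. -/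
theorem continuous_matRoot : Continuous (matRoot : Matrix n n ℂ → Matrix n n ℂ) := by
  unfold matRoot
  exact CFC.continuousOn_sqrt.comp_continuous CFC.continuous_abs fun M => CFC.abs_nonneg M

theorem isHermitian_matRoot (M : Matrix n n ℂ) : (matRoot M).IsHermitian :=
  (Matrix.nonneg_iff_posSemidef.1 (CFC.sqrt_nonneg (CFC.abs M))).isHermitian

theorem matRoot_mul_matRoot {M : Matrix n n ℂ} (hM : M.PosSemidef) :
    matRoot M * matRoot M = M := by
  have h0 : 0 ≤ M := Matrix.nonneg_iff_posSemidef.2 hM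
  unfold matRoot
  rw [CFC.abs_of_nonneg M h0, CFC.sqrt_mul_sqrt_self M h0]

end Root

/-! ### The Hilbert space of the spectral domain -/

/-- The normalized Lebesgue measure of the frequency domain. -/
noncomputable def specMeasure : Measure ℝ :=
  ENNReal.ofReal (1 / (2 * Real.pi)) • volume.restrict freq

theorem specMeasure_const_ne_zero : ENNReal.ofReal (1 / (2 * Real.pi)) ≠ 0 := by
  have := Real.pi_pos
  rw [Ne, ENNReal.ofReal_eq_zero, not_le]; positivity

theorem ae_specMeasure_iff {p : ℝ → Prop} :
    (∀ᵐ x ∂specMeasure, p x) ↔ ∀ᵐ x ∂(volume.restrict freq), p x :=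
  Measure.ae_ennreal_smul_measure_iff specMeasure_const_ne_zero

theorem aestronglyMeasurable_specMeasure_iff {E : Type*} [TopologicalSpace E] {g : ℝ → E} :
    AEStronglyMeasurable g specMeasure ↔ AEStronglyMeasurable g (volume.restrict freq) := by
  unfold AEStronglyMeasurable Filter.EventuallyEq
  simp only [ae_specMeasure_iff]

theorem integrable_specMeasure_iff {g : ℝ → ℂ} :
    Integrable g specMeasure ↔ IntegrableOn g freq :=
  integrable_smul_measure specMeasure_const_ne_zero ENNReal.ofReal_ne_top

instance : IsFiniteMeasure (volume.restrict freq) := by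
  unfold freq; infer_instance

instance : IsFiniteMeasure specMeasure := by
  unfold specMeasure
  exact Measure.smul_finite _ ENNReal.ofReal_ne_top

theorem integral_specMeasure (g : ℝ → ℂ) :
    ∫ x, g x ∂specMeasure = (1 / (2 * Real.pi) : ℂ) * ∫ x in freq, g x := by
  have : 0 ≤ 1 / (2 * Real.pi) := by have := Real.pi_pos; positivity
  unfold specMeasure
  rw [integral_smul_measure, ENNReal.toReal_ofReal this, Complex.real_smul]
  push_cast; rfl

theorem intervalIntegral_eq_freq {E : Type*} [NormedAddCommGroup E] [NormedSpace ℝ E]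
    (g : ℝ → E) : ∫ x in (-Real.pi)..Real.pi, g x = ∫ x in freq, g x :=
  intervalIntegral.integral_of_le (by linarith [Real.pi_pos])

/-- A spectral density matrix which satisfies the minimality condition. -/
structure IsMinimalDensity {T : ℕ} (f : ℝ → Matrix (Fin T) (Fin T) ℂ) : Prop where
  integrable : ∀ ν μ, IntegrableOn (fun x => f x ν μ) freq
  posSemidef : ∀ᵐ x ∂(volume.restrict freq), (f x).PosSemidef
  minimality : Minimality f

section Embedding

variable {T : ℕ} {f : ℝ → Matrix (Fin T) (Fin T) ℂ}

/-- The row vector `bᵀ f^{1/2}`. -/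
noncomputable def embFun (f : ℝ → Matrix (Fin T) (Fin T) ℂ) (b : ℝ → Fin T → ℂ) (x : ℝ) :
    EuclideanSpace ℂ (Fin T) :=
  WithLp.toLp 2 (b x ᵥ* matRoot (f x))

open Classical in
/-- The class of `bᵀ f^{1/2}` in the space of square integrable functions (zero if `b` does not
belong to `L₂(f)`). -/
noncomputable def emb (f : ℝ → Matrix (Fin T) (Fin T) ℂ) (b : ℝ → Fin T → ℂ) :
    Lp (EuclideanSpace ℂ (Fin T)) 2 specMeasure :=
  if h : MemLp (embFun f b) 2 specMeasure then h.toLp else 0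

/-- The root is Hermitian with square `f x`. The arguments are swapped because `inner` is conjugate
linear in its first slot. -/
theorem inner_embFun {x : ℝ} (hx : (f x).PosSemidef) (b c : ℝ → Fin T → ℂ) :
    inner ℂ (embFun f c x) (embFun f b x) = ∑ ν, ∑ μ, b x ν * f x ν μ * conj (c x μ) := by
  unfold embFun
  rw [EuclideanSpace.inner_eq_star_dotProduct]
  simp only
  rw [Matrix.star_vecMul, (isHermitian_matRoot (f x)).eq, ← Matrix.dotProduct_mulVec,
    Matrix.mulVec_mulVec, matRoot_mul_matRoot hx]
  simp [dotProduct, Matrix.mulVec, Finset.mul_sum, mul_assoc]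

theorem quad_eq_norm_embFun {x : ℝ} (hx : (f x).PosSemidef) (b : ℝ → Fin T → ℂ) :
    quad f b x = ((‖embFun f b x‖ ^ 2 : ℝ) : ℂ) := by
  have h := inner_embFun hx b b
  rw [inner_self_eq_norm_sq_to_K] at h
  rw [quad, ← h]
  push_cast; rfl

theorem memL2_zero : MemL2 f 0 := by
  refine ⟨fun ν => aestronglyMeasurable_const, ?_⟩
  have : quad f 0 = 0 := by funext x; simp [quad]
  rw [this]
  exact integrableOn_zero

/-! ### Measurability, linearity and isometry of the embedding of `L₂(f)`. -/

namespace IsMinimalDensity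

variable (hf : IsMinimalDensity f)
include hf

theorem aestronglyMeasurable : AEStronglyMeasurable f (volume.restrict freq) :=
  (aemeasurable_pi_lambda f fun ν => aemeasurable_pi_lambda (fun x => f x ν) fun μ =>
    (hf.integrable ν μ).aestronglyMeasurable.aemeasurable).aestronglyMeasurable

theorem aestronglyMeasurable_matRoot (ν μ : Fin T) :
    AEStronglyMeasurable (fun x => matRoot (f x) ν μ) (volume.restrict freq) := by
  have h : Continuous fun M : Matrix (Fin T) (Fin T) ℂ => matRoot M ν μ :=
    continuous_matRoot.matrix_elem ν μ
  exact h.comp_aestronglyMeasurable hf.aestronglyMeasurable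

theorem aestronglyMeasurable_inv (ν μ : Fin T) :
    AEStronglyMeasurable (fun x => (f x)⁻¹ ν μ) (volume.restrict freq) := by
  have h1 : Continuous fun M : Matrix (Fin T) (Fin T) ℂ => M.det := continuous_id.matrix_det
  have h2 : Continuous fun M : Matrix (Fin T) (Fin T) ℂ => M.adjugate ν μ :=
    continuous_id.matrix_adjugate.matrix_elem ν μ
  simp only [Matrix.inv_def, Matrix.smul_apply, Ring.inverse_eq_inv', smul_eq_mul]
  have h3 := (h1.comp_aestronglyMeasurable hf.aestronglyMeasurable).aemeasurable.inv
  exact h3.aestronglyMeasurable.mul (h2.comp_aestronglyMeasurable hf.aestronglyMeasurable)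

theorem aestronglyMeasurable_embFun {b : ℝ → Fin T → ℂ}
    (hb : ∀ ν, AEStronglyMeasurable (fun x => b x ν) (volume.restrict freq)) :
    AEStronglyMeasurable (embFun f b) (volume.restrict freq) := by
  refine (PiLp.continuous_toLp 2 _).comp_aestronglyMeasurable ?_
  refine (aemeasurable_pi_lambda _ fun μ => ?_).aestronglyMeasurable
  simp only [Matrix.vecMul, dotProduct]
  exact (Finset.aestronglyMeasurable_fun_sum _ fun ν _ =>
    (hb ν).mul (hf.aestronglyMeasurable_matRoot ν μ)).aemeasurable

theorem memL2_iff (b : ℝ → Fin T → ℂ) : MemL2 f b ↔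
    (∀ ν, AEStronglyMeasurable (fun x => b x ν) (volume.restrict freq)) ∧
      MemLp (embFun f b) 2 specMeasure := by
  unfold MemL2
  refine and_congr_right fun hb => ?_
  have hm := hf.aestronglyMeasurable_embFun hb
  rw [memLp_two_iff_integrable_sq_norm (aestronglyMeasurable_specMeasure_iff.2 hm),
    ← integrable_specMeasure_iff]
  have h1 : quad f b =ᵐ[specMeasure] fun x => ((‖embFun f b x‖ ^ 2 : ℝ) : ℂ) := by
    refine ae_specMeasure_iff.2 ?_
    filter_upwards [hf.posSemidef] with x hx using quad_eq_norm_embFun hx b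
  rw [integrable_congr h1]
  exact ⟨fun h => h.re, fun h => h.ofReal⟩

theorem coeFn_emb {b : ℝ → Fin T → ℂ} (hb : MemL2 f b) :
    emb f b =ᵐ[specMeasure] embFun f b := by
  have h := ((hf.memL2_iff b).1 hb).2
  rw [emb, dif_pos h]
  exact h.coeFn_toLp

theorem memL2_add {b c : ℝ → Fin T → ℂ} (hb : MemL2 f b) (hc : MemL2 f c) :
    MemL2 f (b + c) := by
  refine (hf.memL2_iff _).2 ⟨fun ν => (hb.1 ν).add (hc.1 ν), ?_⟩
  have h : embFun f (b + c) = embFun f b + embFun f c := by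
    funext x; simp [embFun, Matrix.add_vecMul]
  rw [h]
  exact ((hf.memL2_iff _).1 hb).2.add ((hf.memL2_iff _).1 hc).2

theorem memL2_smul {b : ℝ → Fin T → ℂ} (hb : MemL2 f b) (a : ℂ) : MemL2 f (a • b) := by
  refine (hf.memL2_iff _).2 ⟨fun ν => (hb.1 ν).const_mul a, ?_⟩
  have h : embFun f (a • b) = a • embFun f b := by
    funext x; simp [embFun, Matrix.smul_vecMul]
  rw [h]
  exact ((hf.memL2_iff _).1 hb).2.const_smul a

theorem memL2_sub {b c : ℝ → Fin T → ℂ} (hb : MemL2 f b) (hc : MemL2 f c) :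
    MemL2 f (b - c) := by
  have := hf.memL2_add hb (hf.memL2_smul hc (-1))
  rwa [neg_one_smul, ← sub_eq_add_neg] at this

theorem memL2_sum {ι : Type*} (s : Finset ι) (a : ι → ℂ) {b : ι → ℝ → Fin T → ℂ}
    (hb : ∀ i, MemL2 f (b i)) : MemL2 f (∑ i ∈ s, a i • b i) :=
  Finset.sum_induction _ (MemL2 f) (fun _ _ => hf.memL2_add) memL2_zero
    fun i _ => hf.memL2_smul (hb i) (a i)

theorem emb_add {b c : ℝ → Fin T → ℂ} (hb : MemL2 f b) (hc : MemL2 f c) :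
    emb f (b + c) = emb f b + emb f c := by
  refine Lp.ext ?_
  filter_upwards [hf.coeFn_emb (hf.memL2_add hb hc), hf.coeFn_emb hb, hf.coeFn_emb hc,
    Lp.coeFn_add (emb f b) (emb f c)] with x h1 h2 h3 h4
  rw [h1, h4, Pi.add_apply, h2, h3]
  simp [embFun, Matrix.add_vecMul]

theorem emb_smul {b : ℝ → Fin T → ℂ} (hb : MemL2 f b) (a : ℂ) :
    emb f (a • b) = a • emb f b := by
  refine Lp.ext ?_
  filter_upwards [hf.coeFn_emb (hf.memL2_smul hb a), hf.coeFn_emb hb,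
    Lp.coeFn_smul a (emb f b)] with x h1 h2 h4
  rw [h1, h4, Pi.smul_apply, h2]
  simp [embFun, Matrix.smul_vecMul]

theorem emb_zero : emb f 0 = 0 := by
  have := hf.emb_smul memL2_zero 0
  rwa [zero_smul, zero_smul] at this

theorem emb_sub {b c : ℝ → Fin T → ℂ} (hb : MemL2 f b) (hc : MemL2 f c) :
    emb f (b - c) = emb f b - emb f c := by
  have h1 := hf.emb_add hb (hf.memL2_smul hc (-1))
  rwa [hf.emb_smul hc, neg_one_smul, neg_one_smul, ← sub_eq_add_neg, ← sub_eq_add_neg] at h1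

theorem emb_sum {ι : Type*} (s : Finset ι) (a : ι → ℂ) {b : ι → ℝ → Fin T → ℂ}
    (hb : ∀ i, MemL2 f (b i)) :
    emb f (∑ i ∈ s, a i • b i) = ∑ i ∈ s, a i • emb f (b i) := by
  classical
  induction s using Finset.induction_on with
  | empty => simpa using hf.emb_zero
  | insert i s hi ih =>
    rw [Finset.sum_insert hi, Finset.sum_insert hi,
      hf.emb_add (hf.memL2_smul (hb i) _) (hf.memL2_sum s a hb), hf.emb_smul (hb i), ih]

theorem inner_emb {b c : ℝ → Fin T → ℂ} (hb : MemL2 f b) (hc : MemL2 f c) :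
    inner ℂ (emb f c) (emb f b) = (1 / (2 * Real.pi) : ℂ) *
      ∫ x in freq, ∑ ν, ∑ μ, b x ν * f x ν μ * conj (c x μ) := by
  rw [L2.inner_def, ← integral_specMeasure]
  refine integral_congr_ae ?_
  filter_upwards [hf.coeFn_emb hb, hf.coeFn_emb hc, ae_specMeasure_iff.2 hf.posSemidef]
    with x h1 h2 hx
  rw [h1, h2, inner_embFun hx]

theorem sqDist_eq {b c : ℝ → Fin T → ℂ} (hb : MemL2 f b) (hc : MemL2 f c) :
    sqDist f b c = ‖emb f b - emb f c‖ ^ 2 := by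
  have hd := hf.memL2_sub hb hc
  rw [← hf.emb_sub hb hc]
  have h1 := hf.inner_emb hd hd
  rw [inner_self_eq_norm_sq_to_K] at h1
  have h2 := congrArg Complex.re h1
  have h3 : (∫ x in freq, quad f (b - c) x).re = ∫ x in freq, (quad f (b - c) x).re :=
    (integral_re hd.2).symm
  rw [show (1 / (2 * Real.pi) : ℂ) = ((1 / (2 * Real.pi) : ℝ) : ℂ) by push_cast; rfl,
    Complex.re_ofReal_mul] at h2
  unfold sqDist
  rw [intervalIntegral_eq_freq]
  change _ * ∫ x in freq, (quad f (b - c) x).re = _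
  rw [← h3]
  change _ = _ * (∫ x in freq, quad f (b - c) x).re at h2
  rw [← h2]
  norm_cast

/-- Multiplying by `f^{1/2}` and then by `f⁻¹` recovers `b` from `bᵀ f^{1/2}`. This turns uniqueness
in the Hilbert space into almost everywhere uniqueness of the minimizer. -/
theorem ae_eq_of_emb_eq {b c : ℝ → Fin T → ℂ} (hb : MemL2 f b) (hc : MemL2 f c)
    (h : emb f b = emb f c) : ∀ᵐ x ∂(volume.restrict freq), b x = c x := by
  have h1 : embFun f b =ᵐ[specMeasure] embFun f c :=
    (hf.coeFn_emb hb).symm.trans (h ▸ hf.coeFn_emb hc)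
  filter_upwards [ae_specMeasure_iff.1 h1, hf.posSemidef, hf.minimality.1] with x h1 h2 h3
  have h4 : b x ᵥ* matRoot (f x) = c x ᵥ* matRoot (f x) := by
    simpa [embFun] using h1
  have h5 := congrArg (fun v => v ᵥ* matRoot (f x)) h4
  simp only [Matrix.vecMul_vecMul, matRoot_mul_matRoot h2] at h5
  have h6 := congrArg (fun v => v ᵥ* (f x)⁻¹) h5
  simpa [Matrix.vecMul_vecMul, Matrix.mul_nonsing_inv _ h3] using h6

/-- Bounded measurable functions belong to `L₂(f)`. -/
theorem memL2_of_bounded {b : ℝ → Fin T → ℂ}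
    (hb : ∀ ν, AEStronglyMeasurable (fun x => b x ν) (volume.restrict freq))
    {C : ℝ} (hC : ∀ x ν, ‖b x ν‖ ≤ C) : MemL2 f b := by
  refine ⟨hb, ?_⟩
  unfold quad
  refine integrable_finsetSum _ fun ν _ => integrable_finsetSum _ fun μ _ => ?_
  have h1 : Integrable (fun x => b x ν * f x ν μ) (volume.restrict freq) :=
    (hf.integrable ν μ).bdd_mul (hb ν) (Filter.Eventually.of_forall fun x => hC x ν)
  refine h1.mul_bdd (c := C) ?_ (Filter.Eventually.of_forall fun x => ?_)
  · exact Complex.continuous_conj.comp_aestronglyMeasurable (hb μ)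
  · simpa using hC x μ

end IsMinimalDensity

end Embedding

/-! ### Exponentials, step functions and the dual family -/

section Families

variable {T : ℕ} {f : ℝ → Matrix (Fin T) (Fin T) ℂ}

/-- The function `e^{ijλ} δ_ν`. -/
noncomputable def basisFun (i : ℤ × Fin T) (x : ℝ) : Fin T → ℂ := Pi.single i.2 (char i.1 x)

/-- The function `1_Δ δ_ν`. -/
noncomputable def stepFun (Δ : Set ℝ) (ν : Fin T) (x : ℝ) : Fin T → ℂ :=
  Pi.single ν (Δ.indicator (fun _ => (1 : ℂ)) x)

/-- The function `e^{ijλ} δ_νᵀ f⁻¹`. -/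
noncomputable def dualFun (f : ℝ → Matrix (Fin T) (Fin T) ℂ) (i : ℤ × Fin T) (x : ℝ) :
    Fin T → ℂ :=
  basisFun i x ᵥ* (f x)⁻¹

theorem sum_sum_eq_dotProduct (M : Matrix (Fin T) (Fin T) ℂ) (b c : Fin T → ℂ) :
    ∑ ν, ∑ μ, b ν * M ν μ * conj (c μ) = (b ᵥ* M) ⬝ᵥ star c := by
  rw [← Matrix.dotProduct_mulVec]
  simp [dotProduct, Matrix.mulVec, Finset.mul_sum, mul_assoc]

theorem norm_diag_le_norm_trace {M : Matrix (Fin T) (Fin T) ℂ} (hM : M.PosSemidef) (ν : Fin T) :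
    ‖M ν ν‖ ≤ ‖M.trace‖ := by
  have h0 : ∀ μ, 0 ≤ M μ μ := fun μ => hM.diag_nonneg
  have h1 : M ν ν ≤ M.trace :=
    Finset.single_le_sum (f := fun μ => M μ μ) (fun μ _ => h0 μ) (Finset.mem_univ ν)
  exact CStarAlgebra.norm_le_norm_of_nonneg_of_le (h0 ν) h1

theorem measurable_single {g : ℝ → ℂ} (hg : AEStronglyMeasurable g (volume.restrict freq))
    (ν μ : Fin T) :
    AEStronglyMeasurable (fun x => (Pi.single ν (g x) : Fin T → ℂ) μ) (volume.restrict freq) := by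
  by_cases h : μ = ν
  · subst h; simpa using hg
  · simpa [h] using (aestronglyMeasurable_const :
      AEStronglyMeasurable (fun _ : ℝ => (0 : ℂ)) (volume.restrict freq))

theorem trigPoly_eq_sum_basisFun (F : Finset ℤ) (p : ℤ → Fin T → ℂ) :
    trigPoly F p = ∑ i ∈ F ×ˢ Finset.univ, p i.1 i.2 • basisFun i := by
  funext x μ
  rw [Finset.sum_product]
  simp only [trigPoly, Finset.sum_apply, Pi.smul_apply, basisFun, smul_eq_mul, Pi.single_apply,
    mul_ite, mul_zero, Finset.sum_ite_eq, Finset.mem_univ, if_true]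
  exact Finset.sum_congr rfl fun j _ => mul_comm _ _

theorem spectralChar_eq (S : Finset ℤ) (a : ℤ → Fin T → ℂ) :
    spectralChar f S a = trigPoly S a -
      ∑ p : S × Fin T, vecC f S a p • dualFun f ((p.1 : ℤ), p.2) := by
  funext x
  rw [spectralChar, Pi.sub_apply]
  congr 1
  have h : stackPoly S (vecC f S a) x =
      ∑ p : S × Fin T, vecC f S a p • basisFun ((p.1 : ℤ), p.2) x := by
    funext μ
    rw [Fintype.sum_prod_type]
    simp only [stackPoly, Finset.sum_apply, Pi.smul_apply, basisFun, smul_eq_mul, Pi.single_apply,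
      mul_ite, mul_zero, Finset.sum_ite_eq, Finset.mem_univ, if_true]
    exact Finset.sum_congr rfl fun j _ => mul_comm _ _
  rw [h, Matrix.sum_vecMul]
  simp [Finset.sum_apply, dualFun, Matrix.smul_vecMul]

theorem sum_indicator_eq_sum_stepFun {n : ℕ} (Δ : Fin n → Set ℝ) (v : Fin n → Fin T → ℂ) :
    (fun x => ∑ i, (Δ i).indicator (fun _ => v i) x) =
      ∑ q : Fin n × Fin T, v q.1 q.2 • stepFun (Δ q.1) q.2 := by
  funext x μ
  rw [Fintype.sum_prod_type]
  simp only [Finset.sum_apply, Pi.smul_apply, stepFun, smul_eq_mul, Pi.single_apply,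
    mul_ite, mul_zero, Finset.sum_ite_eq, Finset.mem_univ, if_true]
  refine Finset.sum_congr rfl fun i _ => ?_
  by_cases hx : x ∈ Δ i <;> simp [hx]

theorem dualFun_apply (i : ℤ × Fin T) (x : ℝ) (μ : Fin T) :
    dualFun f i x μ = char i.1 x * (f x)⁻¹ i.2 μ := by
  simp [dualFun, basisFun, Matrix.single_vecMul]

/-! ### Totality, Gram matrices and biorthogonality. -/

namespace IsMinimalDensity

variable (hf : IsMinimalDensity f)
include hf

theorem memL2_basisFun (i : ℤ × Fin T) : MemL2 f (basisFun i) := by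
  refine hf.memL2_of_bounded (C := 1)
    (fun μ => measurable_single (continuous_char i.1).aestronglyMeasurable i.2 μ) fun x ν => ?_
  by_cases h : ν = i.2
  · subst h; simp [basisFun, norm_char]
  · simp [basisFun, h]

theorem memL2_stepFun {Δ : Set ℝ} (hΔ : MeasurableSet Δ) (ν : Fin T) :
    MemL2 f (stepFun Δ ν) := by
  refine hf.memL2_of_bounded (C := 1)
    (fun μ => measurable_single (aestronglyMeasurable_const.indicator hΔ) ν μ) fun x μ => ?_
  by_cases h : μ = ν
  · subst h
    by_cases hx : x ∈ Δ <;> simp [stepFun, hx]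
  · simp [stepFun, h]

theorem memL2_trigPoly (F : Finset ℤ) (p : ℤ → Fin T → ℂ) : MemL2 f (trigPoly F p) := by
  rw [trigPoly_eq_sum_basisFun]
  exact hf.memL2_sum _ (fun i : ℤ × Fin T => p i.1 i.2) hf.memL2_basisFun

theorem emb_trigPoly (F : Finset ℤ) (p : ℤ → Fin T → ℂ) :
    emb f (trigPoly F p) = ∑ i ∈ F ×ˢ Finset.univ, p i.1 i.2 • emb f (basisFun i) := by
  rw [trigPoly_eq_sum_basisFun]
  exact hf.emb_sum _ (fun i : ℤ × Fin T => p i.1 i.2) hf.memL2_basisFun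

theorem dualFun_vecMul (i : ℤ × Fin T) :
    ∀ᵐ x ∂(volume.restrict freq), dualFun f i x ᵥ* f x = basisFun i x := by
  filter_upwards [hf.minimality.1] with x hx
  rw [dualFun, Matrix.vecMul_vecMul, Matrix.nonsing_inv_mul _ hx, Matrix.vecMul_one]

/-- This is where integrability of the trace enters: the density of the squared norm is the
conjugate of a diagonal entry of `f⁻¹`, which the trace dominates. -/
theorem memL2_dualFun (i : ℤ × Fin T) : MemL2 f (dualFun f i) := by
  constructor
  · intro μ
    simp only [dualFun_apply]
    exact (continuous_char i.1).aestronglyMeasurable.mul (hf.aestronglyMeasurable_inv _ _)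
  · have h1 : ∀ᵐ x ∂(volume.restrict freq), conj ((f x)⁻¹ i.2 i.2) = quad f (dualFun f i) x := by
      filter_upwards [hf.dualFun_vecMul i] with x hx
      rw [quad, sum_sum_eq_dotProduct, hx, basisFun, single_dotProduct, Pi.star_apply,
        dualFun_apply, star_mul', ← mul_assoc]
      have := char_mul_conj i.1 i.1 x
      rw [sub_self] at this
      rw [show star (char i.1 x) = conj (char i.1 x) from rfl, this]
      simp [char]
    refine Integrable.congr ?_ h1
    refine Integrable.mono hf.minimality.2 ?_ ?_
    · exact Complex.continuous_conj.comp_aestronglyMeasurable (hf.aestronglyMeasurable_inv _ _)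
    · filter_upwards [hf.posSemidef] with x hx
      rw [RCLike.norm_conj]
      exact norm_diag_le_norm_trace hx.inv i.2

/-- The factor `f⁻¹` cancels `f`, so the pairing is the conjugate of a Fourier coefficient of `c`.
-/
theorem inner_emb_dualFun (i : ℤ × Fin T) {c : ℝ → Fin T → ℂ} (hc : MemL2 f c) :
    inner ℂ (emb f c) (emb f (dualFun f i)) = (1 / (2 * Real.pi) : ℂ) *
      ∫ x in freq, char i.1 x * conj (c x i.2) := by
  rw [hf.inner_emb (hf.memL2_dualFun i) hc]
  congr 1
  refine integral_congr_ae ?_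
  filter_upwards [hf.dualFun_vecMul i] with x hx
  rw [sum_sum_eq_dotProduct, hx, basisFun, single_dotProduct]
  rfl

/-- Here `u` is any element of the ambient space, not assumed to be some `emb f c`; totality is
needed for all such `u`. -/
theorem inner_emb_left {b : ℝ → Fin T → ℂ} (hb : MemL2 f b)
    (u : Lp (EuclideanSpace ℂ (Fin T)) 2 specMeasure) :
    inner ℂ (emb f b) u = (1 / (2 * Real.pi) : ℂ) *
        ∫ x in freq, (((u x).ofLp) ᵥ* matRoot (f x)) ⬝ᵥ star (b x) ∧
      IntegrableOn (fun x => (((u x).ofLp) ᵥ* matRoot (f x)) ⬝ᵥ star (b x)) freq := by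
  have h : (fun x => inner ℂ (emb f b x) (u x)) =ᵐ[specMeasure]
      fun x => (((u x).ofLp) ᵥ* matRoot (f x)) ⬝ᵥ star (b x) := by
    filter_upwards [hf.coeFn_emb hb] with x hx
    rw [hx, EuclideanSpace.inner_eq_star_dotProduct, embFun, Matrix.star_vecMul,
      (isHermitian_matRoot (f x)).eq, Matrix.dotProduct_mulVec]
  constructor
  · rw [L2.inner_def, ← integral_specMeasure]
    exact integral_congr_ae h
  · rw [← integrable_specMeasure_iff]
    exact (L2.integrable_inner (𝕜 := ℂ) (emb f b) u).congr h

theorem eq_zero_of_vecMul_matRoot (u : Lp (EuclideanSpace ℂ (Fin T)) 2 specMeasure)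
    (h : ∀ ν, ∀ᵐ x ∂(volume.restrict freq), (((u x).ofLp) ᵥ* matRoot (f x)) ν = 0) : u = 0 := by
  rw [Lp.eq_zero_iff_ae_eq_zero]
  refine ae_specMeasure_iff.2 ?_
  filter_upwards [ae_all_iff.2 h, hf.posSemidef, hf.minimality.1] with x h1 h2 h3
  have h4 : (u x).ofLp ᵥ* matRoot (f x) = 0 := funext h1
  have h5 := congrArg (fun v => (v ᵥ* matRoot (f x)) ᵥ* (f x)⁻¹) h4
  simp only [Matrix.vecMul_vecMul, matRoot_mul_matRoot h2, Matrix.mul_nonsing_inv _ h3,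
    Matrix.zero_vecMul, Matrix.vecMul_one] at h5
  ext μ
  exact congrFun h5 μ

theorem integrableOn_vecMul_matRoot (u : Lp (EuclideanSpace ℂ (Fin T)) 2 specMeasure)
    (ν : Fin T) : IntegrableOn (fun x => (((u x).ofLp) ᵥ* matRoot (f x)) ν) freq := by
  -- At time `0` the character is `1`, so the pairing density is the component itself.
  have h := (hf.inner_emb_left (hf.memL2_basisFun (0, ν)) u).2
  simpa [basisFun, char] using h

theorem total_basisFun (u : Lp (EuclideanSpace ℂ (Fin T)) 2 specMeasure)
    (hu : ∀ i, inner ℂ (emb f (basisFun i)) u = 0) : u = 0 := by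
  refine hf.eq_zero_of_vecMul_matRoot u fun ν => ?_
  refine ae_eq_zero_of_fourier_eq_zero (hf.integrableOn_vecMul_matRoot u ν) fun j => ?_
  -- The exponential stands in the conjugated slot, so time `-j` produces `e^{ijλ}`.
  have h := hu (-j, ν)
  rw [(hf.inner_emb_left (hf.memL2_basisFun _) u).1, mul_eq_zero] at h
  have h := h.resolve_left (by simp [Real.pi_ne_zero])
  rw [← h]
  refine integral_congr_ae (Filter.Eventually.of_forall fun x => ?_)
  simp only [basisFun, dotProduct, Pi.star_apply]
  rw [Finset.sum_eq_single ν]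
  · rw [Pi.single_eq_same, mul_comm]
    congr 1
    have := conj_char (-j) x
    rw [neg_neg] at this
    exact this.symm
  · intro μ _ hμ
    simp [hμ]
  · simp

theorem total_stepFun (u : Lp (EuclideanSpace ℂ (Fin T)) 2 specMeasure)
    (hu : ∀ q : {Δ : Set ℝ // MeasurableSet Δ ∧ Δ ⊆ freq} × Fin T,
      inner ℂ (emb f (stepFun q.1.1 q.2)) u = 0) : u = 0 := by
  refine hf.eq_zero_of_vecMul_matRoot u fun ν => ?_
  refine Integrable.ae_eq_zero_of_forall_setIntegral_eq_zero
    (hf.integrableOn_vecMul_matRoot u ν) fun s hs _ => ?_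
  have hm := hs.inter measurableSet_freq
  have h := hu (⟨s ∩ freq, hm, Set.inter_subset_right⟩, ν)
  rw [(hf.inner_emb_left (hf.memL2_stepFun hm ν) u).1, mul_eq_zero] at h
  have h := h.resolve_left (by simp [Real.pi_ne_zero])
  rw [Measure.restrict_restrict hs, ← h, ← Set.inter_eq_self_of_subset_right
    (Set.inter_subset_right : s ∩ freq ⊆ freq), ← setIntegral_indicator hm,
    Set.inter_eq_self_of_subset_right (Set.inter_subset_right : s ∩ freq ⊆ freq)]
  refine integral_congr_ae (Filter.Eventually.of_forall fun x => ?_)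
  by_cases hx : x ∈ s ∩ freq
  · simp [stepFun, hx, -Set.mem_inter_iff]
  · simp [stepFun, hx, -Set.mem_inter_iff]

theorem inner_emb_basisFun (i k : ℤ × Fin T) :
    inner ℂ (emb f (basisFun i)) (emb f (basisFun k)) = (1 / (2 * Real.pi) : ℂ) *
      ∫ x in freq, char (k.1 - i.1) x * f x k.2 i.2 := by
  rw [hf.inner_emb (hf.memL2_basisFun k) (hf.memL2_basisFun i)]
  congr 1
  refine integral_congr_ae (Filter.Eventually.of_forall fun x => ?_)
  simp only []
  rw [sum_sum_eq_dotProduct, basisFun, basisFun, ← Pi.single_star, dotProduct_single,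
    Matrix.single_vecMul]
  rw [← char_mul_conj]
  simp [mul_right_comm]

theorem inner_emb_stepFun {Δ Δ' : Set ℝ} (hΔ : MeasurableSet Δ) (hs : Δ ⊆ freq)
    (hΔ' : MeasurableSet Δ') (ν μ : Fin T) :
    inner ℂ (emb f (stepFun Δ' μ)) (emb f (stepFun Δ ν)) = (1 / (2 * Real.pi) : ℂ) *
      ∫ x in Δ ∩ Δ', f x ν μ := by
  rw [hf.inner_emb (hf.memL2_stepFun hΔ ν) (hf.memL2_stepFun hΔ' μ)]
  congr 1
  rw [← Set.inter_eq_self_of_subset_right (Set.inter_subset_left.trans hs : Δ ∩ Δ' ⊆ freq),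
    ← setIntegral_indicator (hΔ.inter hΔ')]
  refine integral_congr_ae (Filter.Eventually.of_forall fun x => ?_)
  simp only []
  rw [sum_sum_eq_dotProduct, stepFun, stepFun, ← Pi.single_star, dotProduct_single,
    Matrix.single_vecMul]
  by_cases h1 : x ∈ Δ <;> by_cases h2 : x ∈ Δ' <;> simp [h1, h2]

theorem inner_basisFun_dualFun (i k : ℤ × Fin T) :
    inner ℂ (emb f (basisFun i)) (emb f (dualFun f k)) = if i = k then 1 else 0 := by
  rw [hf.inner_emb_dualFun k (hf.memL2_basisFun i)]
  by_cases h2 : k.2 = i.2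
  · have h3 : ∀ x, char k.1 x * conj (basisFun i x k.2) = char (k.1 - i.1) x := by
      intro x
      rw [← char_mul_conj, basisFun, h2, Pi.single_eq_same]
    simp only [h3]
    by_cases h1 : i.1 = k.1
    · rw [if_pos (Prod.ext h1 h2.symm), h1, sub_self]
      have : (Real.pi : ℂ) ≠ 0 := by exact_mod_cast Real.pi_ne_zero
      simp [char, freq, Real.pi_pos.le]
      field_simp
      norm_num
    · rw [if_neg (fun h => h1 (congrArg Prod.fst h)), ← intervalIntegral_eq_freq]
      have hn : k.1 - i.1 ≠ 0 := sub_ne_zero.2 (Ne.symm h1)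
      have hc : Complex.I * ((k.1 - i.1 : ℤ) : ℂ) ≠ 0 :=
        mul_ne_zero Complex.I_ne_zero (by exact_mod_cast hn)
      unfold char
      rw [integral_exp_mul_complex hc]
      have h4 : Complex.exp (Complex.I * ((k.1 - i.1 : ℤ) : ℂ) * (Real.pi : ℝ)) =
          Complex.exp (Complex.I * ((k.1 - i.1 : ℤ) : ℂ) * ((-Real.pi : ℝ) : ℂ)) := by
        rw [Complex.exp_eq_exp_iff_exists_int]
        exact ⟨k.1 - i.1, by push_cast; ring⟩
      rw [h4, sub_self, zero_div, mul_zero]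
  · rw [if_neg (fun h => h2 (congrArg Prod.snd h).symm)]
    simp [basisFun, h2]

/-- The Gram entry contains the conjugate of an entry of `f⁻¹`; since `f⁻¹` is Hermitian, this is
the transposed entry in `B`. -/
theorem matB_eq_gram (S : Finset ℤ) : matB f S =
    Matrix.gram ℂ fun p : S × Fin T => emb f (dualFun f ((p.1 : ℤ), p.2)) := by
  ext p q
  rw [Matrix.gram_apply, hf.inner_emb_dualFun _ (hf.memL2_dualFun _)]
  simp only [matB, Matrix.of_apply]
  rw [intervalIntegral_eq_freq]
  congr 1
  refine integral_congr_ae ?_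
  filter_upwards [hf.posSemidef] with x hx
  rw [dualFun_apply, map_mul, ← mul_assoc, char_mul_conj, mul_comm, Matrix.transpose_apply]
  congr 1
  exact (hx.inv.isHermitian.apply q.2 p.2).symm

/-- `L₂^{s-}(f)` corresponds to the closed linear span of the `e^{ijλ} δ_ν`, `j ∉ S`. -/
theorem memL2Minus_iff (S : Finset ℤ) (b : ℝ → Fin T → ℂ) : MemL2Minus f S b ↔
    MemL2 f b ∧ emb f b ∈ (Submodule.span ℂ {y | ∃ i : ℤ × Fin T,
      i ∉ Set.range (fun p : S × Fin T => ((p.1 : ℤ), p.2)) ∧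
      y = emb f (basisFun i)}).topologicalClosure := by
  have hr : ∀ i : ℤ × Fin T,
      i ∉ Set.range (fun p : S × Fin T => ((p.1 : ℤ), p.2)) ↔ i.1 ∉ S := by
    intro i
    refine not_congr ⟨?_, fun h => ⟨(⟨i.1, h⟩, i.2), rfl⟩⟩
    rintro ⟨p, rfl⟩
    exact p.1.2
  unfold MemL2Minus
  refine and_congr_right fun hb => ?_
  rw [← SetLike.mem_coe, Submodule.topologicalClosure_coe, Metric.mem_closure_iff]
  constructor
  · intro h ε hε
    obtain ⟨F, p, hF, hd⟩ := h (ε ^ 2) (by positivity)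
    refine ⟨emb f (trigPoly F p), ?_, ?_⟩
    · rw [hf.emb_trigPoly]
      refine Submodule.sum_mem _ fun i hi => Submodule.smul_mem _ _ (Submodule.subset_span ?_)
      exact ⟨i, (hr i).2 (Finset.disjoint_left.1 hF (Finset.mem_product.1 hi).1), rfl⟩
    · rw [hf.sqDist_eq hb (hf.memL2_trigPoly F p)] at hd
      rw [dist_eq_norm]
      exact lt_of_pow_lt_pow_left₀ 2 hε.le hd
  · intro h ε hε
    obtain ⟨z, hz, hd⟩ := h (Real.sqrt ε) (Real.sqrt_pos.2 hε)
    have hs : {y | ∃ i : ℤ × Fin T,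
        i ∉ Set.range (fun p : S × Fin T => ((p.1 : ℤ), p.2)) ∧ y = emb f (basisFun i)} =
        (fun i => emb f (basisFun i)) '' {i : ℤ × Fin T | i.1 ∉ S} := by
      ext y
      constructor
      · rintro ⟨i, hi, rfl⟩
        exact ⟨i, (hr i).1 hi, rfl⟩
      · rintro ⟨i, hi, rfl⟩
        exact ⟨i, (hr i).2 hi, rfl⟩
    rw [hs, SetLike.mem_coe, Finsupp.mem_span_image_iff_linearCombination] at hz
    obtain ⟨l, hl, rfl⟩ := hz
    have hl' : ∀ i ∈ l.support, i.1 ∉ S := fun i hi => (Finsupp.mem_supported _ _).1 hl hi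
    -- The times occurring in `l`, paired with all components; the pairs added to the support have
    -- coefficient zero.
    refine ⟨l.support.image Prod.fst, fun j ν => l (j, ν), ?_, ?_⟩
    · rw [Finset.disjoint_left]
      intro j hj
      obtain ⟨i, hi, rfl⟩ := Finset.mem_image.1 hj
      exact hl' i hi
    · rw [hf.sqDist_eq hb (hf.memL2_trigPoly _ _), hf.emb_trigPoly]
      have h1 : ∑ i ∈ l.support.image Prod.fst ×ˢ Finset.univ, l (i.1, i.2) • emb f (basisFun i) =
          Finsupp.linearCombination ℂ (fun i => emb f (basisFun i)) l := by
        rw [Finsupp.linearCombination_apply]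
        refine Eq.symm (Finsupp.sum_of_support_subset l (fun i hi => ?_)
          (fun i c => c • emb f (basisFun i)) fun _ _ => zero_smul _ _)
        exact Finset.mem_product.2 ⟨Finset.mem_image_of_mem _ hi, Finset.mem_univ _⟩
      rw [h1, ← dist_eq_norm]
      exact (Real.lt_sqrt dist_nonneg).1 hd

end IsMinimalDensity

end Families

theorem norm_sub_sq_of_orthogonal {H : Type*} [NormedAddCommGroup H] [InnerProductSpace ℂ H]
    {K : Submodule ℂ H} {A h : H} (hK : h ∈ K) (ho : ∀ k ∈ K, inner ℂ k (A - h) = 0)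
    {g : H} (hg : g ∈ K) : ‖A - g‖ ^ 2 = ‖A - h‖ ^ 2 + ‖h - g‖ ^ 2 := by
  have h1 := norm_add_sq_eq_norm_sq_add_norm_sq_of_inner_eq_zero (h - g) (A - h)
    (ho _ (K.sub_mem hK hg))
  rw [show h - g + (A - h) = A - g by abel] at h1
  rw [sq, sq, sq, h1, add_comm]

/-! ### The time domain -/

section TimeDomain

variable {T : ℕ} {Ω : Type*} [MeasurableSpace Ω] {P : Measure Ω}
  {f : ℝ → Matrix (Fin T) (Fin T) ℂ}

theorem cov_eq_inner (X Y : Lp ℂ 2 P) : cov P X Y = inner ℂ Y X := by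
  rw [L2.inner_def]
  simp [cov, RCLike.inner_apply]

theorem mse_eq_norm_sub_sq (X Y : Lp ℂ 2 P) : mse P X Y = ‖X - Y‖ ^ 2 := by
  have h := inner_self_eq_norm_sq_to_K (𝕜 := ℂ) (X - Y)
  rw [L2.inner_def] at h
  have h2 : ∫ ω, inner ℂ ((X - Y) ω) ((X - Y) ω) ∂P =
      ((∫ ω, ‖(X - Y) ω‖ ^ 2 ∂P : ℝ) : ℂ) := by
    rw [← integral_complex_ofReal]
    refine integral_congr_ae (Filter.Eventually.of_forall fun ω => ?_)
    simp only [inner_self_eq_norm_sq_to_K]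
    push_cast; rfl
  rw [h2] at h
  unfold mse
  exact Complex.ofReal_injective (h.trans (by push_cast; rfl))

/-- Writing the mean as a scalar product with the constant `1` lets the isometry and its adjoint
handle the mean-zero condition. -/
theorem inner_one_eq_integral [IsFiniteMeasure P] (X : Lp ℂ 2 P) :
    inner ℂ (indicatorConstLp 2 MeasurableSet.univ (measure_ne_top P Set.univ) (1 : ℂ)) X =
      ∫ ω, X ω ∂P := by
  rw [L2.inner_indicatorConstLp_one, setIntegral_univ]

/-- Each missing interval ends before a later one begins, so the union in `missing` is disjoint and
no time is counted twice in the functional. -/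
theorem start_add_le_start {N K : ℕ → ℕ} {l m : ℕ} (h : l < m) :
    start N K l + N (l + 1) ≤ start N K m := by
  have h1 : start N K (l + 1) = start N K l + (N (l + 1) + K (l + 1)) := by
    unfold start; rw [Finset.sum_range_succ]
  have h2 : start N K (l + 1) ≤ start N K m := by
    unfold start
    exact Finset.sum_le_sum_of_subset (Finset.range_mono (by omega))
  omega

theorem functional_eq_sum {E : Type*} [AddCommGroup E] [Module ℂ E] (s : ℕ) (N K : ℕ → ℕ)
    (a : ℤ → Fin T → ℂ) (X : ℤ → Fin T → E) :
    functional s N K a X = ∑ i ∈ missing s N K ×ˢ Finset.univ, a i.1 i.2 • X i.1 i.2 := by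
  rw [Finset.sum_product, missing, Finset.sum_biUnion]
  · rfl
  · intro l _ m _ hlm
    rw [Function.onFun, Finset.disjoint_left]
    intro j hj hj'
    rw [Finset.mem_Ico] at hj hj'
    rcases lt_or_gt_of_ne hlm with h | h
    · have := start_add_le_start (N := N) (K := K) h
      omega
    · have := start_add_le_start (N := N) (K := K) h
      omega

namespace IsMinimalDensity

variable (hf : IsMinimalDensity f)
include hf

/-- The spectral isomorphism: an isometry which maps `e^{ijλ} δ_ν` to `X_ν(j)`. -/
theorem exists_spectral_isometry {X : ℤ → Fin T → Lp ℂ 2 P}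
    (hX : ∀ (n m : ℤ) (ν μ : Fin T), cov P (X n ν) (X m μ) =
      (1 / (2 * Real.pi) : ℂ) * ∫ x in (-Real.pi)..Real.pi, char (n - m) x * f x ν μ) :
    ∃ U : Lp (EuclideanSpace ℂ (Fin T)) 2 specMeasure →ₗᵢ[ℂ] Lp ℂ 2 P,
      ∀ i : ℤ × Fin T, U (emb f (basisFun i)) = X i.1 i.2 := by
  refine exists_linearIsometry_of_inner_eq hf.total_basisFun fun i j => ?_
  rw [← cov_eq_inner, hX, hf.inner_emb_basisFun, intervalIntegral_eq_freq]

/-- The stochastic integral is the continuous extension of the integral of step functions. -/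
theorem isStochIntegral_iff {Z : Fin T → Set ℝ → Lp ℂ 2 P}
    {W : Lp (EuclideanSpace ℂ (Fin T)) 2 specMeasure →ₗᵢ[ℂ] Lp ℂ 2 P}
    (hW : ∀ ν Δ, MeasurableSet Δ → Δ ⊆ freq → W (emb f (stepFun Δ ν)) = Z ν Δ)
    (b : ℝ → Fin T → ℂ) (X : Lp ℂ 2 P) :
    IsStochIntegral P f Z b X ↔ MemL2 f b ∧ X = W (emb f b) := by
  have hstep : ∀ {n : ℕ} (Δ : Fin n → Set ℝ) (v : Fin n → Fin T → ℂ),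
      (∀ i, MeasurableSet (Δ i) ∧ Δ i ⊆ freq) →
      MemL2 f (fun x => ∑ i, (Δ i).indicator (fun _ => v i) x) ∧
      emb f (fun x => ∑ i, (Δ i).indicator (fun _ => v i) x) =
        ∑ i, ∑ ν, v i ν • emb f (stepFun (Δ i) ν) ∧
      W (emb f (fun x => ∑ i, (Δ i).indicator (fun _ => v i) x)) =
        ∑ i, ∑ ν, v i ν • Z ν (Δ i) := by
    intro n Δ v hΔ
    have hm : ∀ q : Fin n × Fin T, MemL2 f (stepFun (Δ q.1) q.2) :=
      fun q => hf.memL2_stepFun (hΔ q.1).1 q.2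
    have h1 : emb f (fun x => ∑ i, (Δ i).indicator (fun _ => v i) x) =
        ∑ i, ∑ ν, v i ν • emb f (stepFun (Δ i) ν) := by
      rw [sum_indicator_eq_sum_stepFun,
        hf.emb_sum _ (fun q : Fin n × Fin T => v q.1 q.2) hm, Fintype.sum_prod_type]
    refine ⟨?_, h1, ?_⟩
    · rw [sum_indicator_eq_sum_stepFun]
      exact hf.memL2_sum _ (fun q : Fin n × Fin T => v q.1 q.2) hm
    · rw [h1]
      simp only [map_sum, map_smul]
      exact Finset.sum_congr rfl fun i _ => Finset.sum_congr rfl fun ν _ => by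
        rw [hW ν _ (hΔ i).1 (hΔ i).2]
  unfold IsStochIntegral
  refine and_congr_right fun hb => ⟨fun h => ?_, ?_⟩
  · rw [← sub_eq_zero, ← norm_le_zero_iff]
    refine le_of_forall_pos_le_add fun δ hδ => ?_
    -- `sqDist` and `mse` are squared norms, so each of the two errors is below `δ / 2`.
    obtain ⟨n, Δ, v, hΔ, h1, h2⟩ := h ((δ / 2) ^ 2) (by positivity)
    obtain ⟨hm, -, hZ⟩ := hstep Δ v hΔ
    rw [hf.sqDist_eq hb hm] at h1
    rw [mse_eq_norm_sub_sq, ← hZ] at h2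
    have h1 := lt_of_pow_lt_pow_left₀ 2 (by positivity) h1
    have h2 := lt_of_pow_lt_pow_left₀ 2 (by positivity) h2
    rw [← W.norm_map, map_sub, norm_sub_rev] at h1
    have h3 := norm_sub_le_norm_sub_add_norm_sub X
      (W (emb f (fun x => ∑ i, (Δ i).indicator (fun _ => v i) x))) (W (emb f b))
    linarith
  · rintro rfl ε hε
    -- Totality of the step functions supplies the approximating simple functions.
    have hd : emb f b ∈ (Submodule.span ℂ (Set.range
        fun q : {Δ : Set ℝ // MeasurableSet Δ ∧ Δ ⊆ freq} × Fin T =>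
          emb f (stepFun q.1.1 q.2))).topologicalClosure := by
      rw [topologicalClosure_span_range_eq_top hf.total_stepFun]; trivial
    rw [← SetLike.mem_coe, Submodule.topologicalClosure_coe, Metric.mem_closure_iff] at hd
    obtain ⟨z, hz, hd⟩ := hd (Real.sqrt ε) (Real.sqrt_pos.2 hε)
    obtain ⟨n, c, q, rfl⟩ := Submodule.mem_span_set'.1 hz
    choose r hr using fun i => (q i).2
    have hΔ : ∀ i, MeasurableSet (r i).1.1 ∧ (r i).1.1 ⊆ freq := fun i => (r i).1.2
    obtain ⟨hm, he, hZ⟩ := hstep (fun i => (r i).1.1) (fun i => Pi.single (r i).2 (c i)) hΔ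
    have he' : emb f (fun x => ∑ i, ((r i).1.1).indicator
        (fun _ => (Pi.single (r i).2 (c i) : Fin T → ℂ)) x) = ∑ i, c i • (q i).1 := by
      rw [he]
      refine Finset.sum_congr rfl fun i _ => ?_
      rw [← hr i]
      simp [Pi.single_apply, ite_smul]
    rw [← he', dist_eq_norm] at hd
    have hd2 := (Real.lt_sqrt (norm_nonneg _)).1 hd
    refine ⟨n, fun i => (r i).1.1, fun i => Pi.single (r i).2 (c i), hΔ, ?_, ?_⟩
    · rwa [hf.sqDist_eq hb hm]
    · rw [mse_eq_norm_sub_sq, ← hZ, ← map_sub, W.norm_map]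
      exact hd2

theorem isRandomSpectralMeasure_of_isometry [IsFiniteMeasure P] {X : ℤ → Fin T → Lp ℂ 2 P}
    (h0 : ∀ j ν, ∫ ω, X j ν ω ∂P = 0)
    {U : Lp (EuclideanSpace ℂ (Fin T)) 2 specMeasure →ₗᵢ[ℂ] Lp ℂ 2 P}
    (hU : ∀ i : ℤ × Fin T, U (emb f (basisFun i)) = X i.1 i.2) :
    IsRandomSpectralMeasure P X f fun ν Δ => U (emb f (stepFun Δ ν)) where
  mean_zero ν Δ _ _ := by
    set o := indicatorConstLp 2 MeasurableSet.univ (measure_ne_top P Set.univ) (1 : ℂ)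
    -- The constant `1` is orthogonal to every `X j ν`, so its image under the adjoint is orthogonal
    -- to all exponentials and vanishes; thus every value of `U` has mean zero.
    have h1 : U.toContinuousLinearMap.adjoint o = 0 := by
      refine hf.total_basisFun _ fun i => ?_
      rw [ContinuousLinearMap.adjoint_inner_right, LinearIsometry.coe_toContinuousLinearMap, hU,
        ← inner_conj_symm, inner_one_eq_integral, h0, map_zero]
    rw [← inner_one_eq_integral, ← U.coe_toContinuousLinearMap,
      ← ContinuousLinearMap.adjoint_inner_left, h1, inner_zero_left]
  additive ν Δ Δ' h1 _ h2 _ hd := by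
    rw [← map_add, ← hf.emb_add (hf.memL2_stepFun h1 ν) (hf.memL2_stepFun h2 ν)]
    congr 2
    funext x
    simp only [stepFun, Pi.add_apply, ← Pi.single_add]
    rw [Set.indicator_union_of_disjoint hd]
  orthogonal ν μ Δ Δ' h1 hs h2 _ := by
    rw [cov_eq_inner, U.inner_map_map, hf.inner_emb_stepFun h1 hs h2]
  representation j ν := by
    refine (hf.isStochIntegral_iff (fun _ _ _ _ => rfl) _ _).2
      ⟨hf.memL2_basisFun (j, ν), (hU (j, ν)).symm⟩

/-- The orthogonality relations of `Z` define an isometry `W` on step functions, and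
`representation` says that `W` agrees with `U` on the exponentials. Both families are total, so `W =
U`. -/
theorem isStochIntegral_of_isRandomSpectralMeasure {X : ℤ → Fin T → Lp ℂ 2 P}
    {U : Lp (EuclideanSpace ℂ (Fin T)) 2 specMeasure →ₗᵢ[ℂ] Lp ℂ 2 P}
    (hU : ∀ i : ℤ × Fin T, U (emb f (basisFun i)) = X i.1 i.2)
    {Z : Fin T → Set ℝ → Lp ℂ 2 P} (hZ : IsRandomSpectralMeasure P X f Z)
    {b : ℝ → Fin T → ℂ} (hb : MemL2 f b) : IsStochIntegral P f Z b (U (emb f b)) := by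
  obtain ⟨W, hW⟩ := exists_linearIsometry_of_inner_eq
    (x := fun q : {Δ : Set ℝ // MeasurableSet Δ ∧ Δ ⊆ freq} × Fin T => Z q.2 q.1.1)
    hf.total_stepFun fun p q => by
      rw [← cov_eq_inner, hZ.orthogonal _ _ _ _ q.1.2.1 q.1.2.2 p.1.2.1 p.1.2.2,
        hf.inner_emb_stepFun q.1.2.1 q.1.2.2 p.1.2.1]
  have hW' : ∀ ν Δ, MeasurableSet Δ → Δ ⊆ freq → W (emb f (stepFun Δ ν)) = Z ν Δ :=
    fun ν Δ h1 h2 => hW (⟨Δ, h1, h2⟩, ν)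
  have h : ∀ i : ℤ × Fin T, U (emb f (basisFun i)) = W (emb f (basisFun i)) := fun i => by
    rw [hU]
    exact ((hf.isStochIntegral_iff hW' _ _).1 (hZ.representation i.1 i.2)).2
  rw [hf.isStochIntegral_iff hW']
  exact ⟨hb, linearIsometry_ext_of_total hf.total_basisFun h _⟩

/-! #### The optimal estimate -/

theorem isUnit_det_matB (S : Finset ℤ) : IsUnit (matB f S).det := by
  rw [hf.matB_eq_gram]
  refine isUnit_det_gram (linearIndependent_of_biorthogonal
    (e := fun i => emb f (basisFun i)) (j := fun p : S × Fin T => ((p.1 : ℤ), p.2)) ?_ ?_ ?_)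
  · intro p q h
    simp only [Prod.mk.injEq] at h
    exact Prod.ext (Subtype.ext h.1) h.2
  · intro p; rw [hf.inner_basisFun_dualFun, if_pos rfl]
  · intro p i hi; rw [hf.inner_basisFun_dualFun, if_neg hi]

theorem memL2_spectralChar (S : Finset ℤ) (a : ℤ → Fin T → ℂ) :
    MemL2 f (spectralChar f S a) := by
  rw [spectralChar_eq]
  exact hf.memL2_sub (hf.memL2_trigPoly S a) (hf.memL2_sum _ _ fun _ => hf.memL2_dualFun _)

theorem emb_trigPoly_sub_emb_spectralChar (S : Finset ℤ) (a : ℤ → Fin T → ℂ) :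
    emb f (trigPoly S a) - emb f (spectralChar f S a) =
      ∑ p : S × Fin T, vecC f S a p • emb f (dualFun f ((p.1 : ℤ), p.2)) := by
  have h := hf.memL2_sum Finset.univ (vecC f S a)
    fun p : S × Fin T => hf.memL2_dualFun ((p.1 : ℤ), p.2)
  rw [spectralChar_eq, hf.emb_sub (hf.memL2_trigPoly S a) h, sub_sub_cancel,
    hf.emb_sum _ _ fun p : S × Fin T => hf.memL2_dualFun ((p.1 : ℤ), p.2)]

theorem inner_dualFun_trigPoly (S : Finset ℤ) (a : ℤ → Fin T → ℂ) (p : S × Fin T) :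
    inner ℂ (emb f (dualFun f ((p.1 : ℤ), p.2))) (emb f (trigPoly S a)) = stack S a p := by
  rw [hf.emb_trigPoly, inner_sum, Finset.sum_eq_single ((p.1 : ℤ), p.2)]
  · rw [inner_smul_right, ← inner_conj_symm, hf.inner_basisFun_dualFun, if_pos rfl, map_one,
      mul_one, stack]
  · intro i _ hi
    rw [inner_smul_right, ← inner_conj_symm, hf.inner_basisFun_dualFun, if_neg hi, map_zero,
      mul_zero]
  · intro h
    exact absurd (Finset.mem_product.2 ⟨p.1.2, Finset.mem_univ _⟩) h

/-- Pairing `A - h` with the dual functions gives `B c`, pairing `A` with them gives `a`, and `B c =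
a`. -/
theorem inner_dualFun_spectralChar (S : Finset ℤ) (a : ℤ → Fin T → ℂ) (p : S × Fin T) :
    inner ℂ (emb f (dualFun f ((p.1 : ℤ), p.2))) (emb f (spectralChar f S a)) = 0 := by
  have h1 := hf.emb_trigPoly_sub_emb_spectralChar S a
  rw [sub_eq_iff_eq_add, add_comm, ← sub_eq_iff_eq_add] at h1
  rw [← h1, inner_sub_right, hf.inner_dualFun_trigPoly, sub_eq_zero, inner_sum]
  have h2 : matB f S *ᵥ vecC f S a = stack S a := by
    rw [vecC, Matrix.mulVec_mulVec, Matrix.mul_nonsing_inv _ (hf.isUnit_det_matB S),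
      Matrix.one_mulVec]
  rw [← h2, hf.matB_eq_gram]
  simp only [Matrix.mulVec, dotProduct, Matrix.gram_apply, inner_smul_right]
  exact Finset.sum_congr rfl fun q _ => mul_comm _ _

theorem memL2Minus_iff_inner (S : Finset ℤ) (b : ℝ → Fin T → ℂ) : MemL2Minus f S b ↔
    MemL2 f b ∧ ∀ p : S × Fin T, inner ℂ (emb f (dualFun f ((p.1 : ℤ), p.2))) (emb f b) = 0 := by
  rw [hf.memL2Minus_iff]
  refine and_congr_right fun _ => ?_
  refine mem_closure_span_iff_of_biorthogonal (e := fun i => emb f (basisFun i))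
    hf.total_basisFun (j := fun p : S × Fin T => ((p.1 : ℤ), p.2)) ?_ ?_ ?_ _
  · intro p q h
    simp only [Prod.mk.injEq] at h
    exact Prod.ext (Subtype.ext h.1) h.2
  · intro p; rw [hf.inner_basisFun_dualFun, if_pos rfl]
  · intro p i hi; rw [hf.inner_basisFun_dualFun, if_neg hi]

theorem memL2Minus_spectralChar (S : Finset ℤ) (a : ℤ → Fin T → ℂ) :
    MemL2Minus f S (spectralChar f S a) :=
  (hf.memL2Minus_iff_inner S _).2 ⟨hf.memL2_spectralChar S a, hf.inner_dualFun_spectralChar S a⟩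

/-- Expand only the second factor of `⟨A - h, A - h⟩` in dual functions. As `h` is orthogonal to
them, the coefficient of each `c p` is the conjugate of `a p`. -/
theorem norm_sub_spectralChar_sq (S : Finset ℤ) (a : ℤ → Fin T → ℂ) :
    ((‖emb f (trigPoly S a) - emb f (spectralChar f S a)‖ ^ 2 : ℝ) : ℂ) =
      scalar (vecC f S a) (stack S a) := by
  set A := emb f (trigPoly S a)
  set h := emb f (spectralChar f S a)
  have h1 : inner ℂ (A - h) (A - h) = ((‖A - h‖ ^ 2 : ℝ) : ℂ) := by
    rw [inner_self_eq_norm_sq_to_K]; push_cast; rfl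
  rw [← h1]
  nth_rewrite 2 [hf.emb_trigPoly_sub_emb_spectralChar]
  rw [inner_sum, scalar]
  refine Finset.sum_congr rfl fun p _ => ?_
  rw [inner_smul_right, ← inner_conj_symm, inner_sub_right, hf.inner_dualFun_trigPoly,
    hf.inner_dualFun_spectralChar, sub_zero]

/-- The Pythagorean identity in the spectral domain. -/
theorem sqDist_trigPoly_eq (S : Finset ℤ) (a : ℤ → Fin T → ℂ) {g : ℝ → Fin T → ℂ}
    (hg : MemL2Minus f S g) :
    sqDist f (trigPoly S a) g = sqDist f (trigPoly S a) (spectralChar f S a) +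
      ‖emb f (spectralChar f S a) - emb f g‖ ^ 2 := by
  have h1 := (hf.memL2Minus_iff_inner S g).1 hg
  rw [hf.sqDist_eq (hf.memL2_trigPoly S a) hg.1,
    hf.sqDist_eq (hf.memL2_trigPoly S a) (hf.memL2_spectralChar S a)]
  let K : Submodule ℂ (Lp (EuclideanSpace ℂ (Fin T)) 2 specMeasure) :=
    ⨅ p : S × Fin T, (ℂ ∙ emb f (dualFun f ((p.1 : ℤ), p.2)))ᗮ
  have hK : ∀ u, u ∈ K ↔
      ∀ p : S × Fin T, inner ℂ (emb f (dualFun f ((p.1 : ℤ), p.2))) u = 0 := fun u => by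
    simp only [K, Submodule.mem_iInf, Submodule.mem_orthogonal_singleton_iff_inner_right]
  refine norm_sub_sq_of_orthogonal ((hK _).2 (hf.inner_dualFun_spectralChar S a)) ?_
    ((hK _).2 h1.2)
  intro k hk
  rw [hf.emb_trigPoly_sub_emb_spectralChar, inner_sum]
  refine Finset.sum_eq_zero fun p _ => ?_
  rw [inner_smul_right, ← inner_conj_symm, (hK k).1 hk, map_zero, mul_zero]

/-- The image of `h` lies in the observed space by continuity of `U`, and the error is orthogonal to
each observed `X j ν` because biorthogonality survives the isometry. Pythagoras then singles out
this image. -/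
theorem isOptimalEstimate_iff {X : ℤ → Fin T → Lp ℂ 2 P}
    {U : Lp (EuclideanSpace ℂ (Fin T)) 2 specMeasure →ₗᵢ[ℂ] Lp ℂ 2 P}
    (hU : ∀ i : ℤ × Fin T, U (emb f (basisFun i)) = X i.1 i.2) (S : Finset ℤ)
    (a : ℤ → Fin T → ℂ) (Y : Lp ℂ 2 P) :
    IsOptimalEstimate P X S (U (emb f (trigPoly S a))) Y ↔
      Y = U (emb f (spectralChar f S a)) := by
  have hmem : U (emb f (spectralChar f S a)) ∈ observed P X S := by
    have h1 := ((hf.memL2Minus_iff S _).1 (hf.memL2Minus_spectralChar S a)).2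
    refine map_mem_closure U.continuous h1 fun u hu => ?_
    have hle : Submodule.span ℂ {y | ∃ i : ℤ × Fin T,
        i ∉ Set.range (fun p : S × Fin T => ((p.1 : ℤ), p.2)) ∧ y = emb f (basisFun i)} ≤
        (Submodule.span ℂ {Y | ∃ j : ℤ, j ∉ S ∧ ∃ ν, Y = X j ν}).comap U.toLinearMap := by
      rw [Submodule.span_le]
      rintro _ ⟨i, hi, rfl⟩
      refine Submodule.subset_span ⟨i.1, fun h => hi ⟨(⟨i.1, h⟩, i.2), rfl⟩, i.2, hU i⟩
    exact hle hu
  have horth : ∀ k ∈ observed P X S, inner ℂ k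
      (U (emb f (trigPoly S a)) - U (emb f (spectralChar f S a))) = 0 := by
    intro k hk
    have hle : observed P X S ≤
        (ℂ ∙ (U (emb f (trigPoly S a)) - U (emb f (spectralChar f S a))))ᗮ := by
      refine Submodule.topologicalClosure_minimal _ ?_ (Submodule.isClosed_orthogonal _)
      rw [Submodule.span_le]
      rintro _ ⟨j, hj, ν, rfl⟩
      rw [SetLike.mem_coe, Submodule.mem_orthogonal_singleton_iff_inner_left, ← hU (j, ν),
        ← map_sub, U.inner_map_map, hf.emb_trigPoly_sub_emb_spectralChar, inner_sum]
      refine Finset.sum_eq_zero fun p _ => ?_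
      rw [inner_smul_right, hf.inner_basisFun_dualFun, if_neg, mul_zero]
      rintro h
      rw [Prod.mk.injEq] at h
      exact hj (h.1 ▸ p.1.2)
    exact Submodule.mem_orthogonal_singleton_iff_inner_left.1 (hle hk)
  unfold IsOptimalEstimate
  simp only [mse_eq_norm_sub_sq]
  constructor
  · rintro ⟨hY, hmin⟩
    have h1 := norm_sub_sq_of_orthogonal hmem horth hY
    have h2 := hmin _ hmem
    have h3 : ‖U (emb f (spectralChar f S a)) - Y‖ ^ 2 ≤ 0 := by linarith
    have h4 := pow_eq_zero_iff (two_ne_zero) |>.1 (le_antisymm h3 (sq_nonneg _))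
    exact (sub_eq_zero.1 (norm_eq_zero.1 h4)).symm
  · rintro rfl
    refine ⟨hmem, fun Y' hY' => ?_⟩
    rw [norm_sub_sq_of_orthogonal hmem horth hY']
    exact le_add_of_nonneg_right (sq_nonneg _)

end IsMinimalDensity

end TimeDomain

end PCInterp

/-! ### Transfer to the blocked sequence and conclusion. -/

theorem mainTheorem6 {Ω : Type*} [MeasurableSpace Ω] (P : Measure Ω) [IsProbabilityMeasure P]
    (T : ℕ) (ζ : ℤ → Lp ℂ 2 P) (hζ : IsPC P T ζ)
    (f : ℝ → Matrix (Fin T) (Fin T) ℂ) (hf : IsSpectralDensity P (block T ζ) f)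
    (hmin : Minimality f)
    (s : ℕ) (N K : ℕ → ℕ) (hN : N 0 = 0) (hK : K 0 = 0) (a : ℤ → ℂ) :
    -- the matrix `B` is invertible
    IsUnit (matB f (missing s N K)).det ∧
    -- `h` is the unique minimizer of the mean square error over `L₂^{s-}(f)`
    MemL2Minus f (missing s N K) (spectralChar f (missing s N K) (block T a)) ∧
    (∀ g, MemL2Minus f (missing s N K) g →
      sqDist f (trigPoly (missing s N K) (block T a))
          (spectralChar f (missing s N K) (block T a)) ≤
        sqDist f (trigPoly (missing s N K) (block T a)) g) ∧
    (∀ g, MemL2Minus f (missing s N K) g →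
      sqDist f (trigPoly (missing s N K) (block T a)) g =
        sqDist f (trigPoly (missing s N K) (block T a))
          (spectralChar f (missing s N K) (block T a)) →
      ∀ᵐ x ∂(volume.restrict freq), g x = spectralChar f (missing s N K) (block T a) x) ∧
    -- the value of the minimal mean square error in the spectral domain
    ((sqDist f (trigPoly (missing s N K) (block T a))
        (spectralChar f (missing s N K) (block T a)) : ℝ) : ℂ) =
      scalar (vecC f (missing s N K) (block T a)) (stack (missing s N K) (block T a)) ∧
    -- the orthogonal random measure of the blocked sequence exists, the optimal linear estimate
    -- exists and is unique, it is the stochastic integral of `h`, and its error is `⟨c, a⟩`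
    (∃ Z, IsRandomSpectralMeasure P (block T ζ) f Z) ∧
    (∃! Y : Lp ℂ 2 P, IsOptimalEstimate P (block T ζ) (missing s N K)
      (functional s N K (block T a) (block T ζ)) Y) ∧
    (∀ Y : Lp ℂ 2 P, IsOptimalEstimate P (block T ζ) (missing s N K)
        (functional s N K (block T a) (block T ζ)) Y →
      (∀ Z, IsRandomSpectralMeasure P (block T ζ) f Z →
        IsStochIntegral P f Z (spectralChar f (missing s N K) (block T a)) Y) ∧
      ((mse P (functional s N K (block T a) (block T ζ)) Y : ℝ) : ℂ) =
        scalar (vecC f (missing s N K) (block T a)) (stack (missing s N K) (block T a))) := by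
  have hm : IsMinimalDensity f := ⟨hf.integrable, hf.posSemidef, hmin⟩
  set S := missing s N K
  set α : ℤ → Fin T → ℂ := block T a
  obtain ⟨U, hU⟩ := hm.exists_spectral_isometry hf.cov_eq
  have hA : functional s N K α (block T ζ) = U (emb f (trigPoly S α)) := by
    rw [functional_eq_sum, hm.emb_trigPoly, map_sum]
    exact Finset.sum_congr rfl fun i _ => by rw [map_smul, hU]
  have hopt := hm.isOptimalEstimate_iff hU S α
  rw [← hA] at hopt
  have hval := hm.norm_sub_spectralChar_sq S α
  have hsq := hm.sqDist_eq (hm.memL2_trigPoly S α) (hm.memL2_spectralChar S α)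
  refine ⟨hm.isUnit_det_matB S, hm.memL2Minus_spectralChar S α, fun g hg => ?_,
    fun g hg h => ?_, by rw [hsq, hval],
    ⟨_, hm.isRandomSpectralMeasure_of_isometry (fun j ν => hζ.mean_zero _) hU⟩,
    ⟨_, (hopt _).2 rfl, fun Y hY => (hopt Y).1 hY⟩, fun Y hY => ?_⟩
  · rw [hm.sqDist_trigPoly_eq S α hg]
    exact le_add_of_nonneg_right (sq_nonneg _)
  · rw [hm.sqDist_trigPoly_eq S α hg, add_eq_left, pow_eq_zero_iff two_ne_zero, norm_eq_zero,
      sub_eq_zero] at h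
    exact hm.ae_eq_of_emb_eq hg.1 (hm.memL2_spectralChar S α) h.symm
  · rw [(hopt Y).1 hY]
    refine ⟨fun Z hZ =>
      hm.isStochIntegral_of_isRandomSpectralMeasure hU hZ (hm.memL2_spectralChar S α), ?_⟩
    rw [mse_eq_norm_sub_sq, hA, ← map_sub, U.norm_map, hval]
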